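/- Let $\mathcal C=(C_1,\dots,C_m)$ be complex $3\times4$ matrices of rank $3$ (cameras) whose centers $c_i=\ker C_i\in\mathbb P^3$ are pairwise distinct. For $I\subseteq[m]$ let $\mathcal C_I=(C_i)_{i\in I}$, and let the line multiview variety $\mathcal L_{\mathcal C_I}\subseteq(\mathbb P^2)^{I}$ be the Zariski closure of the set of all tuples $(C_ia\times C_ib)_{i\in I}$, where $a,b\in\mathbb C^4$ span a line in $\mathbb P^3$ that contains no $c_i$, $i\in I$. Let $\sigma\subseteq[m]$ with $|\sigma|=4$ be such that the centers $c_i$, $i\in\sigma$, lie on a line $E_\sigma\subset\mathbb P^3$. Let $\pi_\sigma:(\mathbb P^2)^m\to(\mathbb P^2)^\sigma$ be the projection, and $\mathcal L_{\mathcal C,\sigma}=\pi_\sigma^{-1}(\mathcal L_{\mathcal C_\sigma})$. Let $E_\sigma^*\subset\mathbb P^3$ be a line disjoint from $E_\sigma$, and $f_1,f_2,f_3$ three distinct points of $E_\sigma^*$. Fix homogeneous coordinate vectors of the $c_i$ and $f_j$, denoted by the same symbols. For $\ell\in(\mathbb P^2)^m$ (with any choice of homogeneous coordinate vectors $\ell_i\in\mathbb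 C^3\setminus\{0\}$) let $M_\sigma(\ell)$ be the $4\times4$ matrix with columns $C_i^T\ell_i$, $i\in\sigma$. Write $\sigma=\{i_1,i_2,i_3,i_4\}$, in any order. For $i\in\sigma$ put $h_i=C_i^T\ell_i$ and $e_i(\ell_i)=c_i-(h_i^Tf_2)f_1+(h_i^Tf_1)f_2$, let $$\nu(x,y,z,w)=(x^2,y^2,z^2,w^2,xy,xz,xw,yz,yw,zw)^T,$$ and let $\Phi_{\mathcal C,f,\sigma}(\ell)$ be the $10\times10$ matrix whose columns are the images under $\nu$ of $c_{i_1},c_{i_2},c_{i_3},f_1,f_2,f_3,e_{i_1}(\ell_{i_1}),e_{i_2}(\ell_{i_2}),e_{i_3}(\ell_{i_3}),e_{i_4}(\ell_{i_4})$. Then $$\mathcal L_{\mathcal C,\sigma}=\{\ell\in(\mathbb P^2)^m\mid \operatorname{rank}M_\sigma(\ell)\le2\ \text{and}\ \det\Phi_{\mathcal C,f,\sigma}(\ell)=0\},$$ where both conditions do not depend on the chosen coordinate vectors. -/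

import Mathlib

namespace LineMultiview

/-- The camera center of a camera matrix `A : ℂ⁴ → ℂ³`: its kernel, as a linear subspace of `ℂ⁴`.
If `A` has rank 3, it is one-dimensional, i.e. a point of `ℙ³`. -/
noncomputable def center (A : Matrix (Fin 3) (Fin 4) ℂ) : Submodule ℂ (Fin 4 → ℂ) :=
  LinearMap.ker A.mulVecLin

/-- The span `E_σ` of the centers `c_i`, `i ∈ σ`, as a linear subspace of `ℂ⁴`. The cameras in `σ`
have collinear centers, with `E_σ` as baseline, when its dimension is 2. -/
noncomputable def baseline {ι : Type*} (C : ι → Matrix (Fin 3) (Fin 4) ℂ) (σ : Finset ι) :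
    Submodule ℂ (Fin 4 → ℂ) :=
  ⨆ i ∈ σ, center (C i)

/-- `v` is a tuple of homogeneous coordinate vectors of the tuple `ℓ ∈ (ℙ²)^ι`. -/
def IsRep {ι : Type*} (v : ι → Fin 3 → ℂ) (ℓ : ι → Projectivization ℂ (Fin 3 → ℂ)) : Prop :=
  ∀ i, ∃ h : v i ≠ 0, Projectivization.mk ℂ (v i) h = ℓ i

/-- Multihomogeneous polynomials in the variables `ℓ_{i,j}`, `i ∈ ι`, `j = 1, 2, 3`:
homogeneous of some degree `d i` in each group `ℓ_i` of three variables. -/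
def IsMultihomogeneous {ι : Type*} (p : MvPolynomial (ι × Fin 3) ℂ) : Prop :=
  ∃ d : ι → ℕ, ∀ s ∈ p.support, ∀ i, ∑ j, s (i, j) = d i

/-- `p` vanishes at `ℓ ∈ (ℙ²)^ι`: it vanishes at all homogeneous coordinates of `ℓ` (for a
multihomogeneous `p` the choice of homogeneous coordinates does not matter). -/
def VanishesAt {ι : Type*} (p : MvPolynomial (ι × Fin 3) ℂ)
    (ℓ : ι → Projectivization ℂ (Fin 3 → ℂ)) : Prop :=
  ∀ v : ι → Fin 3 → ℂ, IsRep v ℓ → MvPolynomial.eval (fun ij => v ij.1 ij.2) p = 0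

/-- Zariski closed subsets of `(ℙ²)^ι`: common zero sets of multihomogeneous polynomials. -/
def IsZariskiClosed {ι : Type*} (Z : Set (ι → Projectivization ℂ (Fin 3 → ℂ))) : Prop :=
  ∃ P : Set (MvPolynomial (ι × Fin 3) ℂ),
    (∀ p ∈ P, IsMultihomogeneous p) ∧ Z = {ℓ | ∀ p ∈ P, VanishesAt p ℓ}

/-- Zariski closure in `(ℙ²)^ι`. -/
def zariskiClosure {ι : Type*} (S : Set (ι → Projectivization ℂ (Fin 3 → ℂ))) :
    Set (ι → Projectivization ℂ (Fin 3 → ℂ)) :=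
  ⋂₀ {Z | IsZariskiClosed Z ∧ S ⊆ Z}

/-- The image of the joint camera map: the line spanned by `a, b ∈ ℙ³` is sent to the tuple of
image lines `ℓ_i = (C_i a) × (C_i b)`. It is defined at the lines through no camera center, i.e.
where all these cross products are nonzero (which `IsRep` contains). -/
def jointImage {ι : Type*} (C : ι → Matrix (Fin 3) (Fin 4) ℂ) :
    Set (ι → Projectivization ℂ (Fin 3 → ℂ)) :=
  {ℓ | ∃ a b : Fin 4 → ℂ, LinearIndependent ℂ ![a, b] ∧
    IsRep (fun i => crossProduct ((C i).mulVec a) ((C i).mulVec b)) ℓ}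

/-- The line multiview variety `𝓛_C ⊆ (ℙ²)^ι`. -/
def lineMultiviewVariety {ι : Type*} (C : ι → Matrix (Fin 3) (Fin 4) ℂ) :
    Set (ι → Projectivization ℂ (Fin 3 → ℂ)) :=
  zariskiClosure (jointImage C)

/-- `𝓛_{C,σ} = π_σ⁻¹(𝓛_{C_σ})`, where `C_σ` is the subarrangement indexed by `σ` and `π_σ` the
projection onto the factors indexed by `σ`. -/
def lineMultiviewPreimage {ι : Type*} (C : ι → Matrix (Fin 3) (Fin 4) ℂ) (σ : Finset ι) :
    Set (ι → Projectivization ℂ (Fin 3 → ℂ)) :=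
  (fun ℓ (i : σ) => ℓ i) ⁻¹' lineMultiviewVariety (fun i : σ => C i)

/-- The matrix `M(ℓ)` with columns `C_iᵀ ℓ_i`. -/
def backProjMatrix {ι : Type*} (C : ι → Matrix (Fin 3) (Fin 4) ℂ) (v : ι → Fin 3 → ℂ) :
    Matrix (Fin 4) ι ℂ :=
  Matrix.of fun r i => ((C i).transpose.mulVec (v i)) r

/-- The affine Veronese map `ν : ℂ⁴ → ℂ¹⁰`. -/
def veronese (x : Fin 4 → ℂ) : Fin 10 → ℂ :=
  ![x 0 ^ 2, x 1 ^ 2, x 2 ^ 2, x 3 ^ 2,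
    x 0 * x 1, x 0 * x 2, x 0 * x 3, x 1 * x 2, x 1 * x 3, x 2 * x 3]

/-- `e(ℓ) = c - (hᵀ f₂) f₁ + (hᵀ f₁) f₂`, where `h = Aᵀ ℓ`, for one camera `A` with center `c`. -/
def ePoint (A : Matrix (Fin 3) (Fin 4) ℂ) (c : Fin 4 → ℂ) (f : Fin 3 → Fin 4 → ℂ)
    (w : Fin 3 → ℂ) : Fin 4 → ℂ :=
  c - (A.transpose.mulVec w ⬝ᵥ f 1) • f 0 + (A.transpose.mulVec w ⬝ᵥ f 0) • f 1

/-- The `10 × 10` matrix `Φ` of four cameras `A` with centers `c`: its columns are the Veronese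
images of `c₁, c₂, c₃, f₁, f₂, f₃, e₁(ℓ₁), e₂(ℓ₂), e₃(ℓ₃), e₄(ℓ₄)`. -/
def PhiMatrix (A : Fin 4 → Matrix (Fin 3) (Fin 4) ℂ) (c : Fin 4 → Fin 4 → ℂ)
    (f : Fin 3 → Fin 4 → ℂ) (w : Fin 4 → Fin 3 → ℂ) : Matrix (Fin 10) (Fin 10) ℂ :=
  Matrix.of fun r k => veronese
    ((![c 0, c 1, c 2, f 0, f 1, f 2,
        ePoint (A 0) (c 0) f (w 0), ePoint (A 1) (c 1) f (w 1),
        ePoint (A 2) (c 2) f (w 2), ePoint (A 3) (c 3) f (w 3)] : Fin 10 → Fin 4 → ℂ) k) r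

end LineMultiview

/-!
Let `u 0, u 1` be two of the centers and `u 2, u 3` the points `f 0, f 1`, a basis of `ℂ⁴`. A center
is `c_i = x_i u 0 + y_i u 1`, and the back-projected plane `h_i = C_iᵀ ℓ_i`, which contains `c_i`,
has dual coordinates `(t_i p_i, β_i)` with `p_i = (y_i, -x_i)` and `β_i` its restriction to
`E_σ^*`. The map `ℓ_i ↦ (t_i, β_i)` is a linear isomorphism, so everything is a question about
these coordinates.

*The determinant.* A left null vector of `Φ` is a quadric through three points of `E_σ`, three
points of `E_σ^*` and the `e_i`. It contains both lines, hence is a bilinear form on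
`E_σ × E_σ^*`, and vanishing at `e_i` means `p_iᵀ b β_i = 0`, where `b` is the matrix of the form
up to signs and order of the entries. So `det Φ = 0` exactly when the four `p_i` and `β_i` satisfy
a common nontrivial bilinear relation (`CollinearFrame.det_PhiMatrix_eq_zero_iff`).

*Necessity.* For the image of a line `ab` the plane `h_i` is a multiple of `det (a, b, ·, c_i)`
(`exists_transpose_mulVec_cross`), which is linear in `c_i`. Hence the `h_i` span a space of
dimension at most two, and `β_i` is a multiple of `N (x_i, y_i)` for a fixed matrix `N`, so that
the adjugate of `N` gives a bilinear relation. Both conditions are determinantal and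
multihomogeneous, so they pass to the Zariski closure.

*Sufficiency.* Elementary linear algebra (`exists_graph_or_special`) shows that a configuration
with both properties is either `h_i = s_i (τ p_i, N p_i)` for all `i`, or has all but one `h_i`
proportional to a fixed `(0, q)`. Lines disjoint from the baseline realize all configurations of
the first kind with `τ ≠ 0` (`CollinearFrame.exists_mem_jointImage`), and the remaining ones are
limits of these along explicit curves. Since polynomials are continuous, such limits lie in the
Zariski closure (`mem_zariskiClosure_of_tendsto`).
-/

namespace LineMultiview
open Matrix Filter Topology

/-! ### Cameras, their centers and back-projected planes -/

theorem mulVec_surjective {A : Matrix (Fin 3) (Fin 4) ℂ} (hA : A.rank = 3) :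
    Function.Surjective A.mulVec := by
  have h : LinearMap.range A.mulVecLin = ⊤ := by
    apply Submodule.eq_top_of_finrank_eq
    simpa [Matrix.rank] using hA
  exact LinearMap.range_eq_top.mp h

theorem finrank_center {A : Matrix (Fin 3) (Fin 4) ℂ} (hA : A.rank = 3) :
    Module.finrank ℂ (center A) = 1 := by
  have h := LinearMap.finrank_range_add_finrank_ker A.mulVecLin
  have hA' : Module.finrank ℂ (LinearMap.range A.mulVecLin) = 3 := hA
  rw [hA', Module.finrank_fin_fun] at h
  unfold center
  omega

theorem transpose_mulVec_injective {A : Matrix (Fin 3) (Fin 4) ℂ} (hA : A.rank = 3) :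
    Function.Injective Aᵀ.mulVec := by
  intro v w h
  apply dotProduct_eq
  intro z
  obtain ⟨x, rfl⟩ := mulVec_surjective hA z
  rw [dotProduct_mulVec, dotProduct_mulVec, ← mulVec_transpose, ← mulVec_transpose]
  exact congrArg (· ⬝ᵥ x) h

theorem exists_smul_of_mem_center {A : Matrix (Fin 3) (Fin 4) ℂ} (hA : A.rank = 3)
    {c d : Fin 4 → ℂ} (hc : A *ᵥ c = 0) (hc0 : c ≠ 0) (hd : A *ᵥ d = 0) : ∃ k : ℂ, d = k • c := by
  have hc' : c ∈ center A := hc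
  have hd' : d ∈ center A := hd
  obtain ⟨k, hk⟩ := (finrank_eq_one_iff_of_nonzero' (⟨c, hc'⟩ : center A)
    (by simpa [Subtype.ext_iff] using hc0)).mp (finrank_center hA) ⟨d, hd'⟩
  exact ⟨k, by simpa using (congrArg Subtype.val hk).symm⟩

/-- Every plane through the center of `A` is the back-projection of an image line. -/
theorem exists_transpose_mulVec_eq {A : Matrix (Fin 3) (Fin 4) ℂ} (hA : A.rank = 3)
    {c : Fin 4 → ℂ} (hc : A *ᵥ c = 0) (hc0 : c ≠ 0) {h : Fin 4 → ℂ} (hh : h ⬝ᵥ c = 0) :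
    ∃ w, Aᵀ *ᵥ w = h := by
  -- for a right inverse `D` of `A`, the vectors `D (A x)` and `x` differ by a multiple of `c`,
  -- so that `Dᵀ h` is back-projected to `h`
  choose D hD using mulVec_surjective hA
  refine ⟨fun j => h ⬝ᵥ D (Pi.single j 1), dotProduct_eq _ _ fun x => ?_⟩
  set y : Fin 4 → ℂ := ∑ j, (A *ᵥ x) j • D (Pi.single j 1) with hy
  have hker : A *ᵥ (y - x) = 0 := by
    rw [mulVec_sub, sub_eq_zero, hy, mulVec_sum]
    simp_rw [mulVec_smul, hD]
    exact (pi_eq_sum_univ' (A *ᵥ x)).symm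
  obtain ⟨k, hk⟩ := exists_smul_of_mem_center hA hc hc0 hker
  have hxy : h ⬝ᵥ x = h ⬝ᵥ y := by
    have : h ⬝ᵥ (y - x) = 0 := by rw [hk, dotProduct_smul, hh, smul_zero]
    rw [dotProduct_sub, sub_eq_zero] at this
    exact this.symm
  rw [mulVec_transpose, ← dotProduct_mulVec, hxy, hy, dotProduct_sum]
  simp only [dotProduct_smul, smul_eq_mul]
  simp [dotProduct, mul_comm]

/-- The signed maximal minors of a `3 × 4` matrix, i.e. the generalized cross product of its
rows. -/
def minorVector (A : Matrix (Fin 3) (Fin 4) ℂ) : Fin 4 → ℂ :=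
  ![-(A.submatrix id ![1, 2, 3]).det, (A.submatrix id ![0, 2, 3]).det,
    -(A.submatrix id ![0, 1, 3]).det, (A.submatrix id ![0, 1, 2]).det]

/-- The determinant of four vectors in `ℂ⁴`. -/
def vol (a b x c : Fin 4 → ℂ) : ℂ := (Matrix.of ![a, b, x, c]).det

theorem vol_eq (a b x c : Fin 4 → ℂ) : vol a b x c =
    (a 0 * b 1 - a 1 * b 0) * (x 2 * c 3 - x 3 * c 2)
    - (a 0 * b 2 - a 2 * b 0) * (x 1 * c 3 - x 3 * c 1)
    + (a 0 * b 3 - a 3 * b 0) * (x 1 * c 2 - x 2 * c 1)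
    + (a 1 * b 2 - a 2 * b 1) * (x 0 * c 3 - x 3 * c 0)
    - (a 1 * b 3 - a 3 * b 1) * (x 0 * c 2 - x 2 * c 0)
    + (a 2 * b 3 - a 3 * b 2) * (x 0 * c 1 - x 1 * c 0) := by
  simp [vol, Matrix.det_succ_row_zero, Fin.sum_univ_succ, Fin.succAbove]
  ring

theorem mulVec_minorVector (A : Matrix (Fin 3) (Fin 4) ℂ) : A *ᵥ minorVector A = 0 := by
  ext i
  fin_cases i <;>
  · simp [minorVector, mulVec, dotProduct, Fin.sum_univ_succ, det_fin_three]
    ring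

theorem transpose_mulVec_cross_dotProduct (A : Matrix (Fin 3) (Fin 4) ℂ) (a b x : Fin 4 → ℂ) :
    Aᵀ *ᵥ (crossProduct (A *ᵥ a) (A *ᵥ b)) ⬝ᵥ x = vol a b x (minorVector A) := by
  rw [vol_eq]
  simp [minorVector, mulVec, dotProduct, Fin.sum_univ_succ, det_fin_three, cross_apply]
  ring

/-- The back-projection of the image of the line `ab` is, up to a nonzero constant depending only
on the camera, the plane spanned by that line and the camera center. -/
theorem exists_transpose_mulVec_cross {A : Matrix (Fin 3) (Fin 4) ℂ} (hA : A.rank = 3)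
    {c : Fin 4 → ℂ} (hc : A *ᵥ c = 0) (hc0 : c ≠ 0) :
    ∃ k : ℂ, k ≠ 0 ∧ ∀ a b x,
      Aᵀ *ᵥ (crossProduct (A *ᵥ a) (A *ᵥ b)) ⬝ᵥ x = k * vol a b x c := by
  obtain ⟨k, hk⟩ := exists_smul_of_mem_center hA hc hc0 (mulVec_minorVector A)
  have key : ∀ a b x,
      Aᵀ *ᵥ (crossProduct (A *ᵥ a) (A *ᵥ b)) ⬝ᵥ x = k * vol a b x c := by
    intro a b x
    rw [transpose_mulVec_cross_dotProduct, hk, vol_eq, vol_eq]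
    simp only [Pi.smul_apply, smul_eq_mul]
    ring
  refine ⟨k, ?_, key⟩
  rintro rfl
  obtain ⟨a, ha⟩ := mulVec_surjective hA ![1, 0, 0]
  obtain ⟨b, hb⟩ := mulVec_surjective hA ![0, 1, 0]
  have h0 : Aᵀ *ᵥ (crossProduct (A *ᵥ a) (A *ᵥ b)) = Aᵀ *ᵥ 0 :=
    dotProduct_eq _ _ fun x => by rw [key]; simp
  have h1 := congrFun (transpose_mulVec_injective hA h0) 2
  rw [ha, hb, cross_apply] at h1
  simp at h1

/-! ### Rank conditions and multihomogeneous equations -/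

theorem rank_le_two_iff {ι : Type*} [Fintype ι] (M : Matrix (Fin 4) ι ℂ) :
    M.rank ≤ 2 ↔ ∀ g : Fin 3 → ι, ¬ LinearIndependent ℂ (fun r => M.col (g r)) := by
  rw [rank_eq_finrank_span_cols]
  constructor
  · intro h g hg
    have h1 := finrank_span_eq_card hg
    have h2 : Submodule.span ℂ (Set.range fun r => M.col (g r)) ≤
        Submodule.span ℂ (Set.range M.col) :=
      Submodule.span_mono (by rintro _ ⟨r, rfl⟩; exact ⟨g r, rfl⟩)
    have h3 := Submodule.finrank_mono h2
    simp only [Fintype.card_fin] at h1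
    omega
  · intro h
    by_contra! hlt
    obtain ⟨b, hb, -, hli⟩ := Submodule.exists_fun_fin_finrank_span_eq ℂ (Set.range M.col)
    choose g hg using hb
    have hlt' : 3 ≤ Module.finrank ℂ (Submodule.span ℂ (Set.range M.col)) := hlt
    refine h (fun r => g (Fin.castLE hlt' r)) ?_
    simp_rw [hg]
    exact hli.comp _ (Fin.castLE_injective hlt')

/-- Linear dependence of three vectors, tested by pairing with all triples `X`: unlike fixed
minors, these determinants can be evaluated in any basis. -/
theorem not_linearIndependent_of_det_eq_zero {h : Fin 3 → Fin 4 → ℂ}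
    (H : ∀ X : Fin 3 → Fin 4 → ℂ, (Matrix.of fun s r => h r ⬝ᵥ X s).det = 0) :
    ¬ LinearIndependent ℂ h := by
  intro hli
  have hr : (Matrix.of h).rank = 3 := by
    have := LinearIndependent.rank_matrix (M := Matrix.of h) hli
    simpa using this
  choose D hD using mulVec_surjective hr
  have := H fun s => D (Pi.single s 1)
  have h1 : (Matrix.of fun s r => h r ⬝ᵥ D (Pi.single s 1)) = 1 := by
    ext s r
    have := congrFun (hD (Pi.single s 1)) r
    simp only [mulVec, of_apply] at this ⊢
    rw [this, Matrix.one_apply, Pi.single_apply]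
    simp [eq_comm]
  rw [h1, det_one] at this
  exact one_ne_zero this

/-- The linear form `⟨a, ℓ_i⟩` in the coordinates of the `i`-th factor of `(ℙ²)^ι`. -/
noncomputable def linForm {ι : Type*} (i : ι) (a : Fin 3 → ℂ) : MvPolynomial (ι × Fin 3) ℂ :=
  ∑ j, MvPolynomial.C (a j) * MvPolynomial.X (i, j)

theorem eval_det_linForm {ι : Type*} {n : ℕ} (g : Fin n → ι) (a : Fin n → Fin n → Fin 3 → ℂ)
    (v : ι → Fin 3 → ℂ) :
    MvPolynomial.eval (fun ij => v ij.1 ij.2)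
      (Matrix.of fun s r => linForm (g r) (a s r)).det =
    (Matrix.of fun s r => a s r ⬝ᵥ v (g r)).det := by
  rw [RingHom.map_det]
  congr 1
  ext s r
  simp [linForm, dotProduct]

/-- The weights that turn the multidegree on the coordinate ring of `(ℙ²)^ι` into a weighted
degree. -/
def multiWeight (ι : Type*) [DecidableEq ι] (ij : ι × Fin 3) : ι → ℕ := Pi.single ij.1 1

theorem isWeightedHomogeneous_linForm {ι : Type*} [DecidableEq ι] (i : ι) (a : Fin 3 → ℂ) :
    MvPolynomial.IsWeightedHomogeneous (multiWeight ι) (linForm i a) (Pi.single i 1) :=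
  MvPolynomial.IsWeightedHomogeneous.sum _ _ _ fun j _ =>
    (MvPolynomial.isWeightedHomogeneous_X ℂ (multiWeight ι) (i, j)).C_mul _

section Multihomogeneous

variable {ι : Type*} [Fintype ι] [DecidableEq ι]

theorem IsMultihomogeneous.of_isWeightedHomogeneous {p : MvPolynomial (ι × Fin 3) ℂ} {d : ι → ℕ}
    (hp : MvPolynomial.IsWeightedHomogeneous (multiWeight ι) p d) : IsMultihomogeneous p := by
  refine ⟨d, fun s hs i => ?_⟩
  rw [← hp (MvPolynomial.mem_support_iff.mp hs), Finsupp.weight_apply,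
    Finsupp.sum_fintype _ _ (by simp), Fintype.sum_prod_type, Finset.sum_apply]
  rw [Finset.sum_eq_single i]
  · simp [multiWeight]
  · intro b _ hb
    simp [multiWeight, Ne.symm hb]
  · simp

/-- A determinant each of whose columns consists of linear forms in a single factor is
multihomogeneous. -/
theorem isMultihomogeneous_det {n : ℕ} (g : Fin n → ι) (a : Fin n → Fin n → Fin 3 → ℂ) :
    IsMultihomogeneous (Matrix.of fun s r => linForm (g r) (a s r)).det := by
  refine .of_isWeightedHomogeneous (d := ∑ r, Pi.single (g r) 1) ?_
  rw [det_apply]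
  refine MvPolynomial.IsWeightedHomogeneous.sum _ _ _ fun τ _ => ?_
  have h := MvPolynomial.IsWeightedHomogeneous.prod Finset.univ
    (fun r => linForm (g r) (a (τ r) r)) (fun r => Pi.single (g r) 1)
    fun r _ => isWeightedHomogeneous_linForm (g r) (a (τ r) r)
  rcases Int.units_eq_one_or (Equiv.Perm.sign τ) with h1 | h1 <;> rw [h1]
  · simpa using h
  · simpa using h.neg

end Multihomogeneous

/-! ### Homogeneous coordinates and limits in the Zariski closure -/

theorem IsRep.exists_smul {ι : Type*} {v w : ι → Fin 3 → ℂ}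
    {ℓ : ι → Projectivization ℂ (Fin 3 → ℂ)} (hv : IsRep v ℓ) (hw : IsRep w ℓ) :
    ∃ a : ι → ℂ, (∀ i, a i ≠ 0) ∧ ∀ i, w i = a i • v i := by
  have : ∀ i, ∃ a : ℂ, a ≠ 0 ∧ w i = a • v i := by
    intro i
    obtain ⟨h1, h1'⟩ := hv i
    obtain ⟨h2, h2'⟩ := hw i
    obtain ⟨a, ha⟩ := (Projectivization.mk_eq_mk_iff ℂ _ _ h2 h1).mp (h2'.trans h1'.symm)
    exact ⟨a, a.ne_zero, ha.symm⟩
  choose a ha using this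
  exact ⟨a, fun i => (ha i).1, fun i => (ha i).2⟩

theorem IsRep.smul {ι : Type*} {v : ι → Fin 3 → ℂ}
    {ℓ : ι → Projectivization ℂ (Fin 3 → ℂ)} (hv : IsRep v ℓ) {a : ι → ℂ} (ha : ∀ i, a i ≠ 0) :
    IsRep (fun i => a i • v i) ℓ := by
  intro i
  obtain ⟨h, h'⟩ := hv i
  refine ⟨smul_ne_zero (ha i) h, ?_⟩
  rw [← h', Projectivization.mk_eq_mk_iff']
  exact ⟨a i, rfl⟩

/-- Limits of points of `S` along a punctured neighbourhood of `0 : ℂ` lie in the Zariski closure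
of `S`, because polynomials are continuous for the Euclidean topology. -/
theorem mem_zariskiClosure_of_tendsto {ι : Type*}
    {S : Set (ι → Projectivization ℂ (Fin 3 → ℂ))} {ℓ : ι → Projectivization ℂ (Fin 3 → ℂ)}
    {v : ι → Fin 3 → ℂ} (hv : IsRep v ℓ) {V : ℂ → ι → Fin 3 → ℂ}
    (hV : Tendsto V (𝓝[≠] 0) (𝓝 v)) (hS : ∀ᶠ ε in 𝓝[≠] 0, ∃ ℓ' ∈ S, IsRep (V ε) ℓ') :
    ℓ ∈ zariskiClosure S := by
  rintro Z ⟨⟨P, -, rfl⟩, hSZ⟩ p hp w hw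
  obtain ⟨a, ha, hwv⟩ := hv.exists_smul hw
  have hcont : Continuous fun u : ι → Fin 3 → ℂ =>
      MvPolynomial.eval (fun ij : ι × Fin 3 => (a ij.1 • u ij.1) ij.2) p := by
    refine (MvPolynomial.continuous_eval p).comp ?_
    simp only [Pi.smul_apply]
    fun_prop
  have hlim := (hcont.tendsto v).comp hV
  have hzero : ∀ᶠ ε in 𝓝[≠] 0, (fun u : ι → Fin 3 → ℂ =>
      MvPolynomial.eval (fun ij : ι × Fin 3 => (a ij.1 • u ij.1) ij.2) p) (V ε) = 0 := by
    filter_upwards [hS] with ε hε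
    obtain ⟨ℓ', hℓ', hrep⟩ := hε
    have hvan : ∀ p ∈ P, VanishesAt p ℓ' := hSZ hℓ'
    exact hvan p hp (fun i => a i • V ε i) (hrep.smul ha)
  have h0 := tendsto_nhds_unique hlim
    ((tendsto_congr' hzero).mpr tendsto_const_nhds)
  simp only [← hwv] at h0
  exact h0

/-! ### Normal forms of configurations of planes -/

theorem pair_dotProduct_mulVec (b : Matrix (Fin 2) (Fin 2) ℂ) (x y β₀ β₁ : ℂ) :
    ![y, -x] ⬝ᵥ b *ᵥ ![β₀, β₁] =
      y * (b 0 0 * β₀ + b 0 1 * β₁) - x * (b 1 0 * β₀ + b 1 1 * β₁) := by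
  simp [dotProduct, mulVec, Fin.sum_univ_two]
  ring

section Trichotomy
variable {ι : Type*} {x y t β₀ β₁ : ι → ℂ}

/-- The case of a nondegenerate relation `b` in `exists_graph_or_special`: then `β_i` is a multiple
of `b⁻¹ (x_i, y_i)`, and the rank condition makes the factors proportional to the `t_i`. -/
theorem exists_graph_of_det_ne_zero [Nonempty ι] (hxy : ∀ i, x i ≠ 0 ∨ y i ≠ 0)
    (hne : ∀ i j, i ≠ j → x i * y j - x j * y i ≠ 0)
    (h3 : ∀ i j : ι, ∃ k, k ≠ i ∧ k ≠ j)
    (h0 : ∀ i, t i ≠ 0 ∨ β₀ i ≠ 0 ∨ β₁ i ≠ 0)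
    (hrank : ∀ i j k, ∃ a b c : ℂ, (a ≠ 0 ∨ b ≠ 0 ∨ c ≠ 0) ∧
      a * (t i * x i) + b * (t j * x j) + c * (t k * x k) = 0 ∧
      a * (t i * y i) + b * (t j * y j) + c * (t k * y k) = 0 ∧
      a * β₀ i + b * β₀ j + c * β₀ k = 0 ∧ a * β₁ i + b * β₁ j + c * β₁ k = 0)
    {b₀₀ b₀₁ b₁₀ b₁₁ : ℂ} (hb : b₀₀ * b₁₁ - b₀₁ * b₁₀ ≠ 0)
    (hdep : ∀ i, y i * (b₀₀ * β₀ i + b₀₁ * β₁ i) - x i * (b₁₀ * β₀ i + b₁₁ * β₁ i) = 0) :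
    ∃ (τ n₀₀ n₀₁ n₁₀ n₁₁ : ℂ) (s : ι → ℂ), ∀ i, s i ≠ 0 ∧ t i = s i * τ ∧
      β₀ i = s i * (n₀₀ * y i - n₀₁ * x i) ∧ β₁ i = s i * (n₁₀ * y i - n₁₁ * x i) := by
  have hr : ∀ i, ∃ r, b₀₀ * β₀ i + b₀₁ * β₁ i = r * x i ∧ b₁₀ * β₀ i + b₁₁ * β₁ i = r * y i := by
    intro i
    have := hdep i
    rcases hxy i with h | h
    · refine ⟨(b₀₀ * β₀ i + b₀₁ * β₁ i) / x i, by field_simp, ?_⟩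
      field_simp
      linear_combination -this
    · refine ⟨(b₁₀ * β₀ i + b₁₁ * β₁ i) / y i, ?_, by field_simp⟩
      field_simp
      linear_combination this
  choose r hr0 hr1 using hr
  set Δ := b₀₀ * b₁₁ - b₀₁ * b₁₀ with hΔ
  have hβ0 : ∀ i, Δ * β₀ i = r i * (b₁₁ * x i - b₀₁ * y i) := fun i => by
    linear_combination b₁₁ * hr0 i - b₀₁ * hr1 i
  have hβ1 : ∀ i, Δ * β₁ i = r i * (b₀₀ * y i - b₁₀ * x i) := fun i => by
    linear_combination b₀₀ * hr1 i - b₁₀ * hr0 i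
  have hu : ∀ i, t i ≠ 0 ∨ r i ≠ 0 := by
    intro i
    by_contra! hcon
    have e0 := hβ0 i
    have e1 := hβ1 i
    rw [hcon.2, zero_mul] at e0 e1
    rcases h0 i with h | h | h
    · exact h hcon.1
    · exact h ((mul_eq_zero.mp e0).resolve_left hb)
    · exact h ((mul_eq_zero.mp e1).resolve_left hb)
  -- `h_i` is the pure tensor `(t_i, r_i) ⊗ p_i`; three such tensors are dependent only if their
  -- first factors are proportional
  have hprop : ∀ i j, t i * r j = t j * r i := by
    intro i j
    by_cases hij : i = j
    · subst hij; ring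
    obtain ⟨k, hki, hkj⟩ := h3 i j
    obtain ⟨a, b, c, habc, e1, e2, e3, e4⟩ := hrank i j k
    have f1 : a * (r i * x i) + b * (r j * x j) + c * (r k * x k) = 0 := by
      linear_combination b₀₀ * e3 + b₀₁ * e4 - a * hr0 i - b * hr0 j - c * hr0 k
    have f2 : a * (r i * y i) + b * (r j * y j) + c * (r k * y k) = 0 := by
      linear_combination b₁₀ * e3 + b₁₁ * e4 - a * hr1 i - b * hr1 j - c * hr1 k
    have hik := hne i k hki.symm
    have hjk := hne j k hkj.symm
    have g1 : a * t i * (x i * y k - x k * y i) + b * t j * (x j * y k - x k * y j) = 0 := by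
      linear_combination y k * e1 - x k * e2
    have g2 : a * r i * (x i * y k - x k * y i) + b * r j * (x j * y k - x k * y j) = 0 := by
      linear_combination y k * f1 - x k * f2
    by_cases ha : a = 0
    · by_cases hb' : b = 0
      · have hc : c ≠ 0 := by simpa [ha, hb'] using habc
        subst ha hb'
        simp only [zero_mul, zero_add, mul_eq_zero, hc, false_or] at e1 e2 f1 f2
        have := hxy k
        have := hu k
        tauto
      · have : b * (x j * y k - x k * y j) * (t i * r j - t j * r i) = 0 := by
          linear_combination t i * g2 - r i * g1
        exact sub_eq_zero.mp ((mul_eq_zero.mp this).resolve_left (mul_ne_zero hb' hjk))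
    · have : a * (x i * y k - x k * y i) * (t i * r j - t j * r i) = 0 := by
        linear_combination r j * g1 - t j * g2
      exact sub_eq_zero.mp ((mul_eq_zero.mp this).resolve_left (mul_ne_zero ha hik))
  obtain ⟨o⟩ := ‹Nonempty ι›
  have hs : ∀ i, ∃ s, s ≠ 0 ∧ t i = s * t o ∧ r i = s * r o := by
    intro i
    have := hprop i o
    rcases hu o with h | h
    · have e1 : t i = t i / t o * t o := by field_simp
      have e2 : r i = t i / t o * r o := by field_simp; linear_combination -this
      refine ⟨t i / t o, fun hz => ?_, e1, e2⟩
      rw [hz, zero_mul] at e1 e2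
      exact (hu i).elim (· e1) (· e2)
    · have e1 : t i = r i / r o * t o := by field_simp; linear_combination this
      have e2 : r i = r i / r o * r o := by field_simp
      refine ⟨r i / r o, fun hz => ?_, e1, e2⟩
      rw [hz, zero_mul] at e1 e2
      exact (hu i).elim (· e1) (· e2)
  choose s hs0 hst hsr using hs
  refine ⟨t o, -r o * b₀₁ / Δ, -r o * b₁₁ / Δ, r o * b₀₀ / Δ, r o * b₁₀ / Δ, s,
    fun i => ⟨hs0 i, hst i, ?_, ?_⟩⟩
  · have := hβ0 i
    rw [hsr i] at this
    field_simp
    linear_combination this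
  · have := hβ1 i
    rw [hsr i] at this
    field_simp
    linear_combination this

/-- The case of a relation `m ⊗ n` of rank one in `exists_graph_or_special`: the form `m` vanishes at
`p_i` for at most one `i`, so `n` kills all but at most one of the `β_i`. -/
theorem exists_graph_or_special_of_rank_one [Nonempty ι]
    (hxy : ∀ i, x i ≠ 0 ∨ y i ≠ 0)
    (hne : ∀ i j, i ≠ j → x i * y j - x j * y i ≠ 0)
    (h3 : ∀ i j : ι, ∃ k, k ≠ i ∧ k ≠ j)
    (h0 : ∀ i, t i ≠ 0 ∨ β₀ i ≠ 0 ∨ β₁ i ≠ 0)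
    (hrank : ∀ i j k, ∃ a b c : ℂ, (a ≠ 0 ∨ b ≠ 0 ∨ c ≠ 0) ∧
      a * (t i * x i) + b * (t j * x j) + c * (t k * x k) = 0 ∧
      a * (t i * y i) + b * (t j * y j) + c * (t k * y k) = 0 ∧
      a * β₀ i + b * β₀ j + c * β₀ k = 0 ∧ a * β₁ i + b * β₁ j + c * β₁ k = 0)
    {m₀ m₁ n₀ n₁ : ℂ} (hm : m₀ ≠ 0 ∨ m₁ ≠ 0) (hn : n₀ ≠ 0 ∨ n₁ ≠ 0)
    (hdep : ∀ i, (m₀ * y i - m₁ * x i) * (n₀ * β₀ i + n₁ * β₁ i) = 0) :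
    (∃ (τ n₀₀ n₀₁ n₁₀ n₁₁ : ℂ) (s : ι → ℂ), ∀ i, s i ≠ 0 ∧ t i = s i * τ ∧
      β₀ i = s i * (n₀₀ * y i - n₀₁ * x i) ∧ β₁ i = s i * (n₁₀ * y i - n₁₁ * x i)) ∨
    ∃ (j : ι) (q₀ q₁ : ℂ) (s : ι → ℂ), ∀ i, i ≠ j → s i ≠ 0 ∧ t i = 0 ∧
      β₀ i = s i * q₀ ∧ β₁ i = s i * q₁ := by
  -- all but at most one of the `β_i` are multiples of `(n₁, -n₀)`
  have hs : ∀ i, n₀ * β₀ i + n₁ * β₁ i = 0 → ∃ s, β₀ i = s * n₁ ∧ β₁ i = s * -n₀ := by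
    intro i hi
    rcases hn with h | h
    · refine ⟨-β₁ i / n₀, ?_, by field_simp⟩
      field_simp
      linear_combination hi
    · refine ⟨β₀ i / n₁, by field_simp, ?_⟩
      field_simp
      linear_combination hi
  have hs' : ∀ i, ∃ s, n₀ * β₀ i + n₁ * β₁ i = 0 → β₀ i = s * n₁ ∧ β₁ i = s * -n₀ := by
    intro i
    by_cases hi : n₀ * β₀ i + n₁ * β₁ i = 0
    · exact (hs i hi).imp fun s h _ => h
    · exact ⟨0, fun h => absurd h hi⟩
  clear hs
  choose s hs using hs'
  have hspecial : ∀ j, (∀ i, i ≠ j → t i = 0 ∧ n₀ * β₀ i + n₁ * β₁ i = 0) →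
      ∃ (j : ι) (q₀ q₁ : ℂ) (s : ι → ℂ), ∀ i, i ≠ j → s i ≠ 0 ∧ t i = 0 ∧
        β₀ i = s i * q₀ ∧ β₁ i = s i * q₁ := by
    intro j hj
    refine ⟨j, n₁, -n₀, s, fun i hi => ?_⟩
    obtain ⟨ht, hz⟩ := hj i hi
    obtain ⟨e0, e1⟩ := hs i hz
    refine ⟨fun hsi => ?_, ht, e0, e1⟩
    rw [hsi, zero_mul] at e0 e1
    have := h0 i
    tauto
  by_cases hall : ∀ i, n₀ * β₀ i + n₁ * β₁ i = 0
  · by_cases hone : ∃ j, ∀ i, i ≠ j → t i = 0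
    · obtain ⟨j, hj⟩ := hone
      exact Or.inr (hspecial j fun i hi => ⟨hj i hi, hall i⟩)
    · push Not at hone
      left
      obtain ⟨o⟩ := ‹Nonempty ι›
      obtain ⟨i, -, hi⟩ := hone o
      obtain ⟨j, hji, hj⟩ := hone i
      have hij := hne i j hji.symm
      have e0 := fun k => (hs k (hall k)).1
      have e1 := fun k => (hs k (hall k)).2
      -- the linear form `k ↦ z₀ y_k - z₁ x_k` with value `s_k / t_k` for `k = i, j`
      obtain ⟨z₀, z₁, hzi, hzj⟩ : ∃ z₀ z₁ : ℂ,
          s i = t i * (z₀ * y i - z₁ * x i) ∧ s j = t j * (z₀ * y j - z₁ * x j) := by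
        refine ⟨(x i * (s j / t j) - x j * (s i / t i)) / (x i * y j - x j * y i),
          (y i * (s j / t j) - y j * (s i / t i)) / (x i * y j - x j * y i), ?_, ?_⟩ <;>
        · field_simp
          ring
      have key : ∀ k, t k ≠ 0 ∧ s k = t k * (z₀ * y k - z₁ * x k) := by
        intro k
        by_cases hki : k = i
        · subst hki; exact ⟨hi, hzi⟩
        by_cases hkj : k = j
        · subst hkj; exact ⟨hj, hzj⟩
        obtain ⟨a, b, c, habc, f1, f2, f3, f4⟩ := hrank i j k
        have hc : c ≠ 0 := by
          rintro rfl
          have ga : a * (t i * (x i * y j - x j * y i)) = 0 := by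
            linear_combination y j * f1 - x j * f2
          have gb : b * (t j * (x i * y j - x j * y i)) = 0 := by
            linear_combination x i * f2 - y i * f1
          have ha := (mul_eq_zero.mp ga).resolve_right (mul_ne_zero hi hij)
          have hb := (mul_eq_zero.mp gb).resolve_right (mul_ne_zero hj hij)
          simp [ha, hb] at habc
        have hbs : a * s i + b * s j + c * s k = 0 := by
          rcases hn with h | h
          · rw [e1 i, e1 j, e1 k] at f4
            exact (mul_eq_zero.mp (show n₀ * _ = 0 by linear_combination -f4)).resolve_left h
          · rw [e0 i, e0 j, e0 k] at f3
            exact (mul_eq_zero.mp (show n₁ * _ = 0 by linear_combination f3)).resolve_left h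
        have hsk : s k = t k * (z₀ * y k - z₁ * x k) := by
          have : c * (s k - t k * (z₀ * y k - z₁ * x k)) = 0 := by
            linear_combination hbs - a * hzi - b * hzj - z₀ * f2 + z₁ * f1
          exact sub_eq_zero.mp ((mul_eq_zero.mp this).resolve_left hc)
        refine ⟨fun htk => ?_, hsk⟩
        rw [htk, zero_mul] at hsk
        have g0 := e0 k
        have g1 := e1 k
        rw [hsk, zero_mul] at g0 g1
        have := h0 k
        tauto
      refine ⟨1, n₁ * z₀, n₁ * z₁, -n₀ * z₀, -n₀ * z₁, t, fun k => ⟨(key k).1, by ring, ?_, ?_⟩⟩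
      · rw [e0 k, (key k).2]; ring
      · rw [e1 k, (key k).2]; ring
  · push Not at hall
    obtain ⟨j, hj⟩ := hall
    right
    have hmj := (mul_eq_zero.mp (hdep j)).resolve_right hj
    have hz : ∀ i, i ≠ j → n₀ * β₀ i + n₁ * β₁ i = 0 := by
      intro i hi
      refine (mul_eq_zero.mp (hdep i)).resolve_left fun hmi => ?_
      have hij := hne i j hi
      have g0 : m₀ * (x i * y j - x j * y i) = 0 := by linear_combination x i * hmj - x j * hmi
      have g1 : m₁ * (x i * y j - x j * y i) = 0 := by linear_combination y i * hmj - y j * hmi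
      have := (mul_eq_zero.mp g0).resolve_right hij
      have := (mul_eq_zero.mp g1).resolve_right hij
      tauto
    refine hspecial j fun i hi => ⟨?_, hz i hi⟩
    obtain ⟨k, hki, hkj⟩ := h3 i j
    have hik := hne i k hki.symm
    obtain ⟨a, b, c, habc, f1, f2, f3, f4⟩ := hrank i j k
    have hb : b = 0 := by
      have : b * (n₀ * β₀ j + n₁ * β₁ j) = 0 := by
        linear_combination n₀ * f3 + n₁ * f4 - a * hz i hi - c * hz k hkj
      exact (mul_eq_zero.mp this).resolve_right hj
    subst hb
    by_contra hti
    have ga : a * (t i * (x i * y k - x k * y i)) = 0 := by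
      linear_combination y k * f1 - x k * f2
    have ha := (mul_eq_zero.mp ga).resolve_right (mul_ne_zero hti hik)
    subst ha
    have hc : c ≠ 0 := by simpa using habc
    simp only [zero_mul, zero_add, mul_eq_zero, hc, false_or] at f1 f2 f3 f4
    have := hxy k
    have := h0 k
    tauto

/-- Normal forms of the configurations `h_i = (t_i p_i, β_i)`, `p_i = (y_i, -x_i)`, that span a
space of dimension at most two and satisfy a common bilinear relation `p_iᵀ b β_i = 0`, `b ≠ 0`:
either all `h_i` are multiples of `(τ p_i, N p_i)` for a fixed scalar `τ` and matrix `N`, or all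
but one of them are multiples of a fixed `(0, q)`. -/
theorem exists_graph_or_special [Nonempty ι]
    (hxy : ∀ i, x i ≠ 0 ∨ y i ≠ 0)
    (hne : ∀ i j, i ≠ j → x i * y j - x j * y i ≠ 0)
    (h3 : ∀ i j : ι, ∃ k, k ≠ i ∧ k ≠ j)
    (h0 : ∀ i, t i ≠ 0 ∨ β₀ i ≠ 0 ∨ β₁ i ≠ 0)
    (hrank : ∀ i j k, ∃ a b c : ℂ, (a ≠ 0 ∨ b ≠ 0 ∨ c ≠ 0) ∧
      a * (t i * x i) + b * (t j * x j) + c * (t k * x k) = 0 ∧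
      a * (t i * y i) + b * (t j * y j) + c * (t k * y k) = 0 ∧
      a * β₀ i + b * β₀ j + c * β₀ k = 0 ∧ a * β₁ i + b * β₁ j + c * β₁ k = 0)
    {b : Matrix (Fin 2) (Fin 2) ℂ} (hb : b ≠ 0)
    (hdep : ∀ i, ![y i, -x i] ⬝ᵥ b *ᵥ ![β₀ i, β₁ i] = 0) :
    (∃ (τ n₀₀ n₀₁ n₁₀ n₁₁ : ℂ) (s : ι → ℂ), ∀ i, s i ≠ 0 ∧ t i = s i * τ ∧
      β₀ i = s i * (n₀₀ * y i - n₀₁ * x i) ∧ β₁ i = s i * (n₁₀ * y i - n₁₁ * x i)) ∨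
    ∃ (j : ι) (q₀ q₁ : ℂ) (s : ι → ℂ), ∀ i, i ≠ j → s i ≠ 0 ∧ t i = 0 ∧
      β₀ i = s i * q₀ ∧ β₁ i = s i * q₁ := by
  have hdep' : ∀ i, y i * (b 0 0 * β₀ i + b 0 1 * β₁ i)
      - x i * (b 1 0 * β₀ i + b 1 1 * β₁ i) = 0 := by
    intro i
    rw [← hdep i, pair_dotProduct_mulVec]
  by_cases hdet : b 0 0 * b 1 1 - b 0 1 * b 1 0 = 0
  · by_cases hrow : b 0 0 ≠ 0 ∨ b 0 1 ≠ 0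
    · obtain ⟨μ, h1, h2⟩ : ∃ μ, b 1 0 = μ * b 0 0 ∧ b 1 1 = μ * b 0 1 := by
        rcases hrow with h | h
        · refine ⟨b 1 0 / b 0 0, by field_simp, ?_⟩
          field_simp
          linear_combination hdet
        · refine ⟨b 1 1 / b 0 1, ?_, by field_simp⟩
          field_simp
          linear_combination -hdet
      refine exists_graph_or_special_of_rank_one hxy hne h3 h0 hrank (m₀ := 1) (m₁ := μ)
        (Or.inl one_ne_zero) hrow fun i => ?_
      have := hdep' i
      rw [h1, h2] at this
      linear_combination this
    · push Not at hrow
      have hrow' : b 1 0 ≠ 0 ∨ b 1 1 ≠ 0 := by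
        by_contra! h
        apply hb
        ext i j
        fin_cases i <;> fin_cases j <;> simp [hrow, h]
      refine exists_graph_or_special_of_rank_one hxy hne h3 h0 hrank (m₀ := 0) (m₁ := 1)
        (Or.inr one_ne_zero) hrow' fun i => ?_
      have := hdep' i
      rw [hrow.1, hrow.2] at this
      linear_combination this
  · exact Or.inl (exists_graph_of_det_ne_zero hxy hne h3 h0 hrank hdet hdep')

end Trichotomy

/-! ### Points of the line multiview variety of collinear cameras -/

theorem eventually_add_ne_zero (a : ℂ) : ∀ᶠ ε in 𝓝[≠] (0 : ℂ), a + ε ≠ 0 := by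
  by_cases ha : a = 0
  · simp only [ha, zero_add]
    exact self_mem_nhdsWithin
  · filter_upwards [eventually_ne_nhdsWithin (b := -a) (neg_ne_zero.mpr ha).symm] with ε hε h
    exact hε (eq_neg_of_add_eq_zero_right h)

/-- Coordinates adapted to cameras `C i` with pairwise distinct centers on a common line: a basis
`u` of `ℂ⁴` such that the center of `C i` is `x i • u 0 + y i • u 1`. The baseline is spanned by
`u 0` and `u 1`, and `u 2`, `u 3` span a complementary line. -/
structure CollinearFrame {ι : Type*} (C : ι → Matrix (Fin 3) (Fin 4) ℂ) where
  rank_eq : ∀ i, (C i).rank = 3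
  u : Fin 4 → Fin 4 → ℂ
  linearIndependent : LinearIndependent ℂ u
  x : ι → ℂ
  y : ι → ℂ
  ne_zero : ∀ i, x i ≠ 0 ∨ y i ≠ 0
  mulVec_center : ∀ i, C i *ᵥ (x i • u 0 + y i • u 1) = 0
  distinct : ∀ i j, i ≠ j → x i * y j - x j * y i ≠ 0

namespace CollinearFrame

variable {ι : Type*} {C : ι → Matrix (Fin 3) (Fin 4) ℂ} (F : CollinearFrame C)

theorem isUnit_of : IsUnit (Matrix.of F.u) :=
  linearIndependent_rows_iff_isUnit.mp F.linearIndependent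

theorem vol_ne_zero : vol (F.u 0) (F.u 1) (F.u 2) (F.u 3) ≠ 0 := by
  have h := (Matrix.isUnit_iff_isUnit_det _).mp F.isUnit_of
  have hu : F.u = ![F.u 0, F.u 1, F.u 2, F.u 3] := by
    ext k; fin_cases k <;> rfl
  rw [hu] at h
  exact h.ne_zero

theorem eq_of_dotProduct_eq {h h' : Fin 4 → ℂ} (H : ∀ k, h ⬝ᵥ F.u k = h' ⬝ᵥ F.u k) : h = h' := by
  refine (mulVec_injective_iff_isUnit.mpr F.isUnit_of) (funext fun k => ?_)
  simpa [mulVec, dotProduct_comm] using H k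

theorem exists_dotProduct_eq (d : Fin 4 → ℂ) : ∃ h : Fin 4 → ℂ, ∀ k, h ⬝ᵥ F.u k = d k := by
  obtain ⟨h, hh⟩ := (mulVec_surjective_iff_isUnit.mpr F.isUnit_of) d
  refine ⟨h, fun k => ?_⟩
  rw [← hh, dotProduct_comm]
  rfl

theorem center_ne_zero (i : ι) : F.x i • F.u 0 + F.y i • F.u 1 ≠ 0 := by
  intro h
  have := Fintype.linearIndependent_iff.mp F.linearIndependent ![F.x i, F.y i, 0, 0]
    (by simpa [Fin.sum_univ_four] using h)
  have h0 := this 0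
  have h1 := this 1
  simp only [cons_val_zero, cons_val_one] at h0 h1
  exact (F.ne_zero i).elim (· h0) (· h1)

/-- The back-projected plane `h = C_iᵀ w` of the image line `w` has coordinates
`(t • p_i, β₀, β₁)` in the basis dual to `u`, where `p_i = (y_i, -x_i)`. A plane through the
`i`-th center has such coordinates. -/
def HasCoords (i : ι) (w : Fin 3 → ℂ) (t β₀ β₁ : ℂ) : Prop :=
  (C i)ᵀ *ᵥ w ⬝ᵥ F.u 0 = t * F.y i ∧ (C i)ᵀ *ᵥ w ⬝ᵥ F.u 1 = -(t * F.x i) ∧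
    (C i)ᵀ *ᵥ w ⬝ᵥ F.u 2 = β₀ ∧ (C i)ᵀ *ᵥ w ⬝ᵥ F.u 3 = β₁

variable {F}

theorem HasCoords.smul {i : ι} {w : Fin 3 → ℂ} {t β₀ β₁ : ℂ} (h : F.HasCoords i w t β₀ β₁)
    (a : ℂ) : F.HasCoords i (a • w) (a * t) (a * β₀) (a * β₁) := by
  obtain ⟨h0, h1, h2, h3⟩ := h
  simp only [HasCoords, mulVec_smul, smul_dotProduct, smul_eq_mul, h0, h1, h2, h3]
  exact ⟨by ring, by ring, trivial, trivial⟩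

theorem HasCoords.add {i : ι} {w w' : Fin 3 → ℂ} {t β₀ β₁ t' β₀' β₁' : ℂ}
    (h : F.HasCoords i w t β₀ β₁) (h' : F.HasCoords i w' t' β₀' β₁') :
    F.HasCoords i (w + w') (t + t') (β₀ + β₀') (β₁ + β₁') := by
  obtain ⟨h0, h1, h2, h3⟩ := h
  obtain ⟨h0', h1', h2', h3'⟩ := h'
  simp only [HasCoords, mulVec_add, add_dotProduct, h0, h1, h2, h3, h0', h1', h2', h3']
  exact ⟨by ring, by ring, trivial, trivial⟩

theorem HasCoords.unique {i : ι} {w w' : Fin 3 → ℂ} {t β₀ β₁ : ℂ}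
    (h : F.HasCoords i w t β₀ β₁) (h' : F.HasCoords i w' t β₀ β₁) : w = w' := by
  refine transpose_mulVec_injective (F.rank_eq i) (F.eq_of_dotProduct_eq fun k => ?_)
  fin_cases k
  · exact h.1.trans h'.1.symm
  · exact h.2.1.trans h'.2.1.symm
  · exact h.2.2.1.trans h'.2.2.1.symm
  · exact h.2.2.2.trans h'.2.2.2.symm

theorem HasCoords.ne_zero {i : ι} {w : Fin 3 → ℂ} {t β₀ β₁ : ℂ}
    (h : F.HasCoords i w t β₀ β₁) (hw : w ≠ 0) : t ≠ 0 ∨ β₀ ≠ 0 ∨ β₁ ≠ 0 := by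
  by_contra! hcon
  obtain ⟨rfl, rfl, rfl⟩ := hcon
  have h' := h.smul 0
  simp only [zero_smul, mul_zero] at h'
  exact hw (h.unique h')

variable (F)

theorem exists_hasCoords (i : ι) (w : Fin 3 → ℂ) :
    ∃ t, F.HasCoords i w t ((C i)ᵀ *ᵥ w ⬝ᵥ F.u 2) ((C i)ᵀ *ᵥ w ⬝ᵥ F.u 3) := by
  have h : (C i)ᵀ *ᵥ w ⬝ᵥ (F.x i • F.u 0 + F.y i • F.u 1) = 0 := by
    rw [mulVec_transpose, ← dotProduct_mulVec, F.mulVec_center, dotProduct_zero]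
  rw [dotProduct_add, dotProduct_smul, dotProduct_smul, smul_eq_mul, smul_eq_mul] at h
  rcases F.ne_zero i with hx | hy
  · refine ⟨-((C i)ᵀ *ᵥ w ⬝ᵥ F.u 1) / F.x i, ?_, ?_, rfl, rfl⟩
    · field_simp
      linear_combination h
    · field_simp
  · refine ⟨((C i)ᵀ *ᵥ w ⬝ᵥ F.u 0) / F.y i, ?_, ?_, rfl, rfl⟩
    · field_simp
    · field_simp
      linear_combination h

theorem exists_of_coords (i : ι) (t β₀ β₁ : ℂ) : ∃ w, F.HasCoords i w t β₀ β₁ := by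
  obtain ⟨h, hh⟩ := F.exists_dotProduct_eq ![t * F.y i, -(t * F.x i), β₀, β₁]
  have hc : h ⬝ᵥ (F.x i • F.u 0 + F.y i • F.u 1) = 0 := by
    rw [dotProduct_add, dotProduct_smul, dotProduct_smul, hh, hh]
    simp
    ring
  obtain ⟨w, rfl⟩ := exists_transpose_mulVec_eq (F.rank_eq i) (F.mulVec_center i)
    (F.center_ne_zero i) hc
  exact ⟨w, hh 0, hh 1, hh 2, hh 3⟩

/-- The image line with prescribed coordinates depends continuously on them. -/
theorem exists_continuous_of_coords (i : ι) : ∃ L : ℂ × ℂ × ℂ → Fin 3 → ℂ, Continuous L ∧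
    ∀ t β₀ β₁, F.HasCoords i (L (t, β₀, β₁)) t β₀ β₁ := by
  obtain ⟨w₀, h₀⟩ := F.exists_of_coords i 1 0 0
  obtain ⟨w₁, h₁⟩ := F.exists_of_coords i 0 1 0
  obtain ⟨w₂, h₂⟩ := F.exists_of_coords i 0 0 1
  refine ⟨fun z => z.1 • w₀ + z.2.1 • w₁ + z.2.2 • w₂, by fun_prop, fun t β₀ β₁ => ?_⟩
  simpa using ((h₀.smul t).add (h₁.smul β₀)).add (h₂.smul β₁)

/-- The lines disjoint from the baseline are the graphs of linear maps. Their back-projected planes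
are, up to scaling, `(τ p_i, N p_i)` with a scalar `τ ≠ 0` and a matrix `N` independent of `i`. -/
theorem exists_mem_jointImage {v : ι → Fin 3 → ℂ} {τ n₀₀ n₀₁ n₁₀ n₁₁ : ℂ} (hτ : τ ≠ 0)
    {s : ι → ℂ} (hs : ∀ i, s i ≠ 0)
    (hv : ∀ i, F.HasCoords i (v i) (s i * τ) (s i * (n₀₀ * F.y i - n₀₁ * F.x i))
      (s i * (n₁₀ * F.y i - n₁₁ * F.x i))) :
    ∃ ℓ ∈ jointImage C, IsRep v ℓ := by
  have hv0 : ∀ i, v i ≠ 0 := by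
    intro i h
    have := hv i
    rw [h] at this
    obtain ⟨h0, h1, -⟩ := this
    simp only [mulVec_zero, zero_dotProduct] at h0 h1
    rcases F.ne_zero i with hx | hy
    · exact neg_ne_zero.mpr (mul_ne_zero (mul_ne_zero (hs i) hτ) hx) h1.symm
    · exact mul_ne_zero (mul_ne_zero (hs i) hτ) hy h0.symm
  refine ⟨fun i => Projectivization.mk ℂ (v i) (hv0 i), ?_, fun i => ⟨hv0 i, rfl⟩⟩
  set a : Fin 4 → ℂ := τ • F.u 2 - (n₀₀ • F.u 0 + n₀₁ • F.u 1) with ha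
  set b : Fin 4 → ℂ := τ • F.u 3 - (n₁₀ • F.u 0 + n₁₁ • F.u 1) with hb
  have hab : LinearIndependent ℂ ![a, b] := by
    rw [LinearIndependent.pair_iff]
    intro p q hpq
    have := Fintype.linearIndependent_iff.mp F.linearIndependent
      ![-(p * n₀₀ + q * n₁₀), -(p * n₀₁ + q * n₁₁), p * τ, q * τ] (by
        rw [← hpq, ha, hb, Fin.sum_univ_four]
        ext k
        simp
        ring)
    have h2 := this 2
    have h3 := this 3
    simp only [cons_val, mul_eq_zero, hτ, or_false] at h2 h3
    exact ⟨h2, h3⟩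
  refine ⟨a, b, hab, fun i => ?_⟩
  obtain ⟨k, hk, hcross⟩ := exists_transpose_mulVec_cross (F.rank_eq i) (F.mulVec_center i)
    (F.center_ne_zero i)
  set δ := vol (F.u 0) (F.u 1) (F.u 2) (F.u 3) with hδ
  have hδ0 : δ ≠ 0 := F.vol_ne_zero
  have hcoords : F.HasCoords i (crossProduct (C i *ᵥ a) (C i *ᵥ b))
      (k * τ * δ / s i * (s i * τ))
      (k * τ * δ / s i * (s i * (n₀₀ * F.y i - n₀₁ * F.x i)))
      (k * τ * δ / s i * (s i * (n₁₀ * F.y i - n₁₁ * F.x i))) := by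
    have hsi := hs i
    refine ⟨?_, ?_, ?_, ?_⟩ <;>
    · rw [hcross, hδ, ha, hb, vol_eq, vol_eq]
      simp only [Pi.smul_apply, Pi.add_apply, Pi.sub_apply, smul_eq_mul]
      field_simp
      ring
  have heq := hcoords.unique ((hv i).smul (k * τ * δ / s i))
  have hne : k * τ * δ / s i ≠ 0 := div_ne_zero (mul_ne_zero (mul_ne_zero hk hτ) hδ0) (hs i)
  have h0 : crossProduct (C i *ᵥ a) (C i *ᵥ b) ≠ 0 := heq ▸ smul_ne_zero hne (hv0 i)
  refine ⟨h0, ?_⟩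
  rw [Projectivization.mk_eq_mk_iff']
  exact ⟨_, heq.symm⟩

/-- Configurations `s_i (τ p_i, N p_i)` lie in the line multiview variety even for `τ = 0`, as
limits of those with `τ ≠ 0`. -/
theorem mem_variety_of_graph {v : ι → Fin 3 → ℂ} {ℓ : ι → Projectivization ℂ (Fin 3 → ℂ)}
    (hrep : IsRep v ℓ) {τ n₀₀ n₀₁ n₁₀ n₁₁ : ℂ}
    {s : ι → ℂ} (hs : ∀ i, s i ≠ 0)
    (hv : ∀ i, F.HasCoords i (v i) (s i * τ) (s i * (n₀₀ * F.y i - n₀₁ * F.x i))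
      (s i * (n₁₀ * F.y i - n₁₁ * F.x i))) :
    ℓ ∈ lineMultiviewVariety C := by
  choose L hLc hL using F.exists_continuous_of_coords
  refine mem_zariskiClosure_of_tendsto hrep (V := fun ε i => L i (s i * (τ + ε),
    s i * (n₀₀ * F.y i - n₀₁ * F.x i), s i * (n₁₀ * F.y i - n₁₁ * F.x i))) ?_ ?_
  · have hcont : Continuous fun (ε : ℂ) i => L i (s i * (τ + ε),
        s i * (n₀₀ * F.y i - n₀₁ * F.x i), s i * (n₁₀ * F.y i - n₁₁ * F.x i)) :=
      continuous_pi fun i => (hLc i).comp (by fun_prop)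
    have hlim := (hcont.tendsto 0).mono_left (nhdsWithin_le_nhds (s := {0}ᶜ))
    simp only [add_zero] at hlim
    rwa [show (fun i => L i (s i * τ, s i * (n₀₀ * F.y i - n₀₁ * F.x i),
      s i * (n₁₀ * F.y i - n₁₁ * F.x i))) = v from
      funext fun i => (hL i _ _ _).unique (hv i)] at hlim
  · filter_upwards [eventually_add_ne_zero τ] with ε hε
    exact F.exists_mem_jointImage hε hs fun i => hL i _ _ _

open Classical in
/-- Configurations with all but one of the `h_i` multiples of a fixed `(0, q)` lie in the line
multiview variety. -/
theorem mem_variety_of_special {v : ι → Fin 3 → ℂ} {ℓ : ι → Projectivization ℂ (Fin 3 → ℂ)}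
    (hrep : IsRep v ℓ) {j : ι} {t B₀ B₁ q₀ q₁ : ℂ} (hj : F.HasCoords j (v j) t B₀ B₁)
    {s : ι → ℂ} (hs : ∀ i, i ≠ j → s i ≠ 0)
    (hv : ∀ i, i ≠ j → F.HasCoords i (v i) 0 (s i * q₀) (s i * q₁)) :
    ℓ ∈ lineMultiviewVariety C := by
  choose L hLc hL using F.exists_continuous_of_coords
  obtain ⟨w₀, w₁, hw⟩ : ∃ w₀ w₁ : ℂ, w₀ * F.y j - w₁ * F.x j = 1 := by
    rcases F.ne_zero j with h | h
    · exact ⟨0, -1 / F.x j, by field_simp; ring⟩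
    · exact ⟨1 / F.y j, 0, by field_simp; ring⟩
  -- `N = q zᵀ + ε T`, where `z` annihilates `p_j` only and `T p_j = B`; the scaling factor `1 / ε`
  -- at `j` and `τ = ε (t + ε)` make the `j`-th plane `((t + ε) p_j, B)`
  set z : ι → ℂ := fun i => F.x j * F.y i - F.y j * F.x i with hz
  have hzne : ∀ i, i ≠ j → z i ≠ 0 := fun i hi h => F.distinct i j hi (by
    linear_combination -h)
  let V : ℂ → ι → Fin 3 → ℂ := fun ε i => if i = j then L i (t + ε, B₀, B₁) else
    L i (s i / z i * (ε * (t + ε)),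
      s i * q₀ + ε * (s i / z i * B₀ * (w₀ * F.y i - w₁ * F.x i)),
      s i * q₁ + ε * (s i / z i * B₁ * (w₀ * F.y i - w₁ * F.x i)))
  refine mem_zariskiClosure_of_tendsto hrep (V := V) ?_ ?_
  · have hcont : Continuous V := by
      refine continuous_pi fun i => ?_
      by_cases hi : i = j
      · simp only [V, hi, if_true]
        exact (hLc j).comp (by fun_prop)
      · simp only [V, hi, if_false]
        exact (hLc i).comp (by fun_prop)
    have hlim := (hcont.tendsto 0).mono_left (nhdsWithin_le_nhds (s := {0}ᶜ))
    rwa [show V 0 = v from funext fun i => ?_] at hlim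
    by_cases hi : i = j
    · subst hi
      simpa [V] using (hL i _ _ _).unique hj
    · simpa [V, hi] using (hL i _ _ _).unique (hv i hi)
  · filter_upwards [eventually_add_ne_zero t, self_mem_nhdsWithin] with ε hε hε0
    have hε0' : ε ≠ 0 := hε0
    refine F.exists_mem_jointImage (τ := ε * (t + ε))
      (n₀₀ := q₀ * F.x j + ε * B₀ * w₀) (n₀₁ := q₀ * F.y j + ε * B₀ * w₁)
      (n₁₀ := q₁ * F.x j + ε * B₁ * w₀) (n₁₁ := q₁ * F.y j + ε * B₁ * w₁)
      (s := fun i => if i = j then 1 / ε else s i / z i) (mul_ne_zero hε0' hε) ?_ ?_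
    · intro i
      by_cases hi : i = j
      · simpa [hi] using hε0'
      · simpa [hi] using ⟨hs i hi, hzne i hi⟩
    · intro i
      by_cases hi : i = j
      · subst hi
        simp only [V, if_true]
        convert hL i (t + ε) B₀ B₁ using 1
        · field_simp
        · field_simp
          linear_combination B₀ * ε * hw
        · field_simp
          linear_combination B₁ * ε * hw
      · simp only [V, hi, if_false]
        have hzi := hzne i hi
        convert hL i _ _ _ using 1
        · field_simp
          simp only [hz]
          ring
        · field_simp
          simp only [hz]
          ring

end CollinearFrame

/-! ### Equations of the line multiview variety of collinear cameras -/

/-- A determinantal equation, multihomogeneous in the image lines, that holds on the joint image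
holds on its Zariski closure. -/
theorem det_eq_zero_of_mem_variety {ι : Type*} [Fintype ι] [DecidableEq ι]
    {C : ι → Matrix (Fin 3) (Fin 4) ℂ} (v : ι → Fin 3 → ℂ) (ℓ : ι → Projectivization ℂ (Fin 3 → ℂ))
    (hv : IsRep v ℓ) (hℓ : ℓ ∈ lineMultiviewVariety C) {n : ℕ} (g : Fin n → ι)
    (a : Fin n → Fin n → Fin 3 → ℂ)
    (H : ∀ v ℓ, ℓ ∈ jointImage C → IsRep v ℓ →
      (Matrix.of fun s r => a s r ⬝ᵥ v (g r)).det = 0) :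
    (Matrix.of fun s r => a s r ⬝ᵥ v (g r)).det = 0 := by
  have hclosed : IsZariskiClosed {ℓ : ι → Projectivization ℂ (Fin 3 → ℂ) |
      ∀ p ∈ ({(Matrix.of fun s r => linForm (g r) (a s r)).det} : Set (MvPolynomial _ ℂ)),
        VanishesAt p ℓ} :=
    ⟨_, fun p hp => by rw [Set.mem_singleton_iff.mp hp]; exact isMultihomogeneous_det g a, rfl⟩
  have hmem := hℓ _ ⟨hclosed, fun ℓ' hℓ' p hp w hw => by
    rw [Set.mem_singleton_iff.mp hp, eval_det_linForm]
    exact H w ℓ' hℓ' hw⟩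
  have hmem' : ∀ p ∈ ({(Matrix.of fun s r => linForm (g r) (a s r)).det} :
    Set (MvPolynomial _ ℂ)), VanishesAt p ℓ := hmem
  have := hmem' _ (Set.mem_singleton _) v hv
  rwa [eval_det_linForm] at this

namespace CollinearFrame
variable {ι : Type*} {C : ι → Matrix (Fin 3) (Fin 4) ℂ} (F : CollinearFrame C)

/-- The planes `h_i` obtained from a line `ab` span a space of dimension at most two, and their
restrictions to the line spanned by `u 2` and `u 3` depend linearly on the center. -/
theorem exists_of_mem_jointImage {v : ι → Fin 3 → ℂ} {ℓ : ι → Projectivization ℂ (Fin 3 → ℂ)}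
    (hℓ : ℓ ∈ jointImage C) (hv : IsRep v ℓ) :
    ∃ (φ ψ : (Fin 4 → ℂ) → ℂ) (r : ι → ℂ), ∀ i z,
      (C i *ᵥ z) ⬝ᵥ v i = r i * (F.x i * φ z + F.y i * ψ z) := by
  obtain ⟨a, b, -, hab⟩ := hℓ
  obtain ⟨s, -, hs⟩ := hab.exists_smul hv
  choose k hk hcross using fun i => exists_transpose_mulVec_cross (F.rank_eq i)
    (F.mulVec_center i) (F.center_ne_zero i)
  refine ⟨fun z => vol a b z (F.u 0), fun z => vol a b z (F.u 1), fun i => s i * k i,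
    fun i z => ?_⟩
  rw [dotProduct_comm, dotProduct_mulVec, ← mulVec_transpose, hs, mulVec_smul, smul_dotProduct,
    hcross]
  simp only [vol_eq, Pi.smul_apply, Pi.add_apply, smul_eq_mul]
  ring

variable [Fintype ι] [DecidableEq ι]

theorem rank_le_two_of_mem_variety (F : CollinearFrame C) {v : ι → Fin 3 → ℂ}
    {ℓ : ι → Projectivization ℂ (Fin 3 → ℂ)} (hv : IsRep v ℓ) (hℓ : ℓ ∈ lineMultiviewVariety C) : (backProjMatrix C v).rank ≤ 2 := by
  refine (rank_le_two_iff _).mpr fun g => not_linearIndependent_of_det_eq_zero fun X => ?_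
  have := det_eq_zero_of_mem_variety v ℓ hv hℓ g (fun s r => C (g r) *ᵥ X s) ?_
  · rw [← this]
    congr 2
    ext s r
    rw [dotProduct_comm (C (g r) *ᵥ X s), dotProduct_mulVec, ← mulVec_transpose]
    rfl
  · intro v ℓ hℓ hv
    obtain ⟨φ, ψ, r, h⟩ := F.exists_of_mem_jointImage hℓ hv
    simp only [h, det_fin_three, of_apply]
    ring

theorem exists_bilinear_of_mem_variety {v : ι → Fin 3 → ℂ}
    {ℓ : ι → Projectivization ℂ (Fin 3 → ℂ)}
    (hv : IsRep v ℓ) (hℓ : ℓ ∈ lineMultiviewVariety C) (e : Fin 4 ≃ ι) :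
    ∃ b : Matrix (Fin 2) (Fin 2) ℂ, b ≠ 0 ∧ ∀ i, ![F.y i, -F.x i] ⬝ᵥ
      b *ᵥ ![(C i)ᵀ *ᵥ v i ⬝ᵥ F.u 2, (C i)ᵀ *ᵥ v i ⬝ᵥ F.u 3] = 0 := by
  -- the columns of this determinant are the tensors `p_i ⊗ β_i`
  have := det_eq_zero_of_mem_variety v ℓ hv hℓ e (fun s k =>
    ![F.y (e k) • (C (e k) *ᵥ F.u 2), F.y (e k) • (C (e k) *ᵥ F.u 3),
      F.x (e k) • (C (e k) *ᵥ F.u 2), F.x (e k) • (C (e k) *ᵥ F.u 3)] s) ?_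
  · obtain ⟨d, hd0, hd⟩ := exists_vecMul_eq_zero_iff.mpr this
    refine ⟨!![d 0, d 1; -d 2, -d 3], fun h => hd0 ?_, fun i => ?_⟩
    · have h00 := congrFun₂ h 0 0
      have h01 := congrFun₂ h 0 1
      have h10 := congrFun₂ h 1 0
      have h11 := congrFun₂ h 1 1
      simp at h00 h01 h10 h11
      ext k
      fin_cases k <;> simp [h00, h01, h10, h11]
    · obtain ⟨k, rfl⟩ := e.surjective i
      have h := congrFun hd k
      have hdot : ∀ z, (C (e k) *ᵥ z) ⬝ᵥ v (e k) = (C (e k))ᵀ *ᵥ v (e k) ⬝ᵥ z := fun z => by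
        rw [dotProduct_comm, dotProduct_mulVec, ← mulVec_transpose]
      simp only [vecMul, dotProduct, Fin.sum_univ_four, of_apply, cons_val, Pi.zero_apply] at h
      simp only [← dotProduct.eq_1, smul_dotProduct, hdot] at h
      rw [← h, pair_dotProduct_mulVec]
      simp
      ring
  · intro v ℓ hℓ hv
    obtain ⟨φ, ψ, r, h⟩ := F.exists_of_mem_jointImage hℓ hv
    by_cases hN : φ (F.u 2) = 0 ∧ φ (F.u 3) = 0 ∧ ψ (F.u 2) = 0 ∧ ψ (F.u 3) = 0
    · obtain ⟨h1, h2, h3, h4⟩ := hN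
      refine det_eq_zero_of_column_eq_zero 0 fun s => ?_
      fin_cases s <;> simp [smul_dotProduct, h, h1, h2, h3, h4]
    · -- `β_i` is a multiple of `N (x_i, y_i)`, and the adjugate of `N` gives a bilinear relation
      refine exists_vecMul_eq_zero_iff.mp
        ⟨![ψ (F.u 3), -ψ (F.u 2), φ (F.u 3), -φ (F.u 2)], fun h0 => hN ?_, ?_⟩
      · have h1 := congrFun h0 0
        have h2 := congrFun h0 1
        have h3 := congrFun h0 2
        have h4 := congrFun h0 3
        simp at h1 h2 h3 h4
        exact ⟨h4, h3, h2, h1⟩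
      · ext k
        simp only [vecMul, dotProduct, Fin.sum_univ_four, of_apply, cons_val, Pi.zero_apply]
        simp only [← dotProduct.eq_1, smul_dotProduct, h, smul_eq_mul]
        ring

/-- For four cameras with collinear centers, the line multiview variety is cut out by the rank
condition and the existence of a common bilinear relation `p_iᵀ b β_i = 0`. -/
theorem mem_variety_iff {v : ι → Fin 3 → ℂ}
    {ℓ : ι → Projectivization ℂ (Fin 3 → ℂ)} (hv : IsRep v ℓ) (e : Fin 4 ≃ ι) :
    ℓ ∈ lineMultiviewVariety C ↔ (backProjMatrix C v).rank ≤ 2 ∧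
      ∃ b : Matrix (Fin 2) (Fin 2) ℂ, b ≠ 0 ∧ ∀ i, ![F.y i, -F.x i] ⬝ᵥ
        b *ᵥ ![(C i)ᵀ *ᵥ v i ⬝ᵥ F.u 2, (C i)ᵀ *ᵥ v i ⬝ᵥ F.u 3] = 0 := by
  refine ⟨fun h => ⟨F.rank_le_two_of_mem_variety hv h, F.exists_bilinear_of_mem_variety hv h e⟩, ?_⟩
  rintro ⟨hrank, b, hb, hdep⟩
  choose t ht using fun i => F.exists_hasCoords i (v i)
  have hne : Nonempty ι := ⟨e 0⟩
  have h3 : ∀ i j : ι, ∃ k, k ≠ i ∧ k ≠ j := by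
    intro i j
    have h4 : ∀ i j : Fin 4, ∃ k, k ≠ i ∧ k ≠ j := by decide
    obtain ⟨k, hk, hk'⟩ := h4 (e.symm i) (e.symm j)
    exact ⟨e k, fun h => hk (by simp [← h]), fun h => hk' (by simp [← h])⟩
  have hrel : ∀ i j k, ∃ a b c : ℂ, (a ≠ 0 ∨ b ≠ 0 ∨ c ≠ 0) ∧ ∀ z,
      a * ((C i)ᵀ *ᵥ v i ⬝ᵥ z) + b * ((C j)ᵀ *ᵥ v j ⬝ᵥ z) + c * ((C k)ᵀ *ᵥ v k ⬝ᵥ z) = 0 := by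
    intro i j k
    have h := (rank_le_two_iff _).mp hrank ![i, j, k]
    rw [Fintype.not_linearIndependent_iff] at h
    obtain ⟨a, ha, l, hl⟩ := h
    refine ⟨a 0, a 1, a 2, ?_, fun z => ?_⟩
    · fin_cases l <;> simp_all
    · have h := congrArg (· ⬝ᵥ z) ha
      simp only [Fin.sum_univ_three, add_dotProduct, smul_dotProduct, zero_dotProduct,
        smul_eq_mul] at h
      exact h
  have key := exists_graph_or_special (t := t) F.ne_zero F.distinct h3
    (fun i => (ht i).ne_zero (hv i).1) (fun i j k => ?_) hb hdep
  · rcases key with ⟨τ, n₀₀, n₀₁, n₁₀, n₁₁, s, hs⟩ | ⟨j, q₀, q₁, s, hs⟩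
    · refine F.mem_variety_of_graph hv (τ := τ) (n₀₀ := n₀₀) (n₀₁ := n₀₁) (n₁₀ := n₁₀)
        (n₁₁ := n₁₁) (fun i => (hs i).1) fun i => ?_
      obtain ⟨-, h1, h2, h3⟩ := hs i
      rw [← h1, ← h2, ← h3]
      exact ht i
    · refine F.mem_variety_of_special hv (q₀ := q₀) (q₁ := q₁) (ht j)
        (fun i hi => (hs i hi).1) fun i hi => ?_
      obtain ⟨-, h1, h2, h3⟩ := hs i hi
      rw [← h1, ← h2, ← h3]
      exact ht i
  · obtain ⟨a, b, c, habc, h⟩ := hrel i j k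
    refine ⟨a, b, c, habc, ?_, ?_, h _, h _⟩
    · have := h (F.u 1)
      rw [(ht i).2.1, (ht j).2.1, (ht k).2.1] at this
      linear_combination -this
    · have := h (F.u 0)
      rwa [(ht i).1, (ht j).1, (ht k).1] at this

end CollinearFrame

/-! ### Quadrics and the matrix `Φ` -/

/-- The quadratic form on `ℂ⁴` with coefficient vector `q`. -/
def quadric (q : Fin 10 → ℂ) (z : Fin 4 → ℂ) : ℂ := q ⬝ᵥ veronese z

/-- The polar form of `quadric q`. -/
def quadricPolar (q : Fin 10 → ℂ) (z w : Fin 4 → ℂ) : ℂ :=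
  quadric q (z + w) - quadric q z - quadric q w

theorem quadric_eq (q : Fin 10 → ℂ) (z : Fin 4 → ℂ) : quadric q z =
    q 0 * z 0 ^ 2 + q 1 * z 1 ^ 2 + q 2 * z 2 ^ 2 + q 3 * z 3 ^ 2 + q 4 * (z 0 * z 1)
    + q 5 * (z 0 * z 2) + q 6 * (z 0 * z 3) + q 7 * (z 1 * z 2) + q 8 * (z 1 * z 3)
    + q 9 * (z 2 * z 3) := by
  simp [quadric, veronese, dotProduct, Fin.sum_univ_succ]
  ring

theorem quadric_combination (q : Fin 10 → ℂ) (u : Fin 4 → Fin 4 → ℂ) (a b c d : ℂ) :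
    quadric q (a • u 0 + b • u 1 + (c • u 2 + d • u 3)) =
      a ^ 2 * quadric q (u 0) + b ^ 2 * quadric q (u 1) + c ^ 2 * quadric q (u 2)
      + d ^ 2 * quadric q (u 3) + a * b * quadricPolar q (u 0) (u 1)
      + a * c * quadricPolar q (u 0) (u 2) + a * d * quadricPolar q (u 0) (u 3)
      + b * c * quadricPolar q (u 1) (u 2) + b * d * quadricPolar q (u 1) (u 3)
      + c * d * quadricPolar q (u 2) (u 3) := by
  simp only [quadricPolar, quadric_eq, Pi.add_apply, Pi.smul_apply, smul_eq_mul]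
  ring

theorem eq_zero_of_quadric_eq_zero {q : Fin 10 → ℂ} (h : ∀ z, quadric q z = 0) : q = 0 := by
  have h0 := h ![1, 0, 0, 0]
  have h1 := h ![0, 1, 0, 0]
  have h2 := h ![0, 0, 1, 0]
  have h3 := h ![0, 0, 0, 1]
  have h4 := h ![1, 1, 0, 0]
  have h5 := h ![1, 0, 1, 0]
  have h6 := h ![1, 0, 0, 1]
  have h7 := h ![0, 1, 1, 0]
  have h8 := h ![0, 1, 0, 1]
  have h9 := h ![0, 0, 1, 1]
  simp [quadric_eq] at h0 h1 h2 h3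
  simp [quadric_eq, h0, h1, h2, h3] at h4 h5 h6 h7 h8 h9
  ext k
  fin_cases k <;> simp [*]

/-- The coefficient vector of the product of two linear forms. -/
def mulForms (η ξ : Fin 4 → ℂ) : Fin 10 → ℂ :=
  ![η 0 * ξ 0, η 1 * ξ 1, η 2 * ξ 2, η 3 * ξ 3, η 0 * ξ 1 + η 1 * ξ 0, η 0 * ξ 2 + η 2 * ξ 0,
    η 0 * ξ 3 + η 3 * ξ 0, η 1 * ξ 2 + η 2 * ξ 1, η 1 * ξ 3 + η 3 * ξ 1, η 2 * ξ 3 + η 3 * ξ 2]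

theorem quadric_mulForms (η ξ z : Fin 4 → ℂ) :
    quadric (mulForms η ξ) z = (η ⬝ᵥ z) * (ξ ⬝ᵥ z) := by
  simp only [quadric_eq, mulForms, cons_val, dotProduct, Fin.sum_univ_four]
  ring

theorem det_PhiMatrix_eq_zero_iff_exists_quadric (A : Fin 4 → Matrix (Fin 3) (Fin 4) ℂ)
    (c : Fin 4 → Fin 4 → ℂ) (f : Fin 3 → Fin 4 → ℂ) (w : Fin 4 → Fin 3 → ℂ) :
    (PhiMatrix A c f w).det = 0 ↔ ∃ q, q ≠ 0 ∧ quadric q (c 0) = 0 ∧ quadric q (c 1) = 0 ∧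
      quadric q (c 2) = 0 ∧ (∀ j, quadric q (f j) = 0) ∧
      ∀ k, quadric q (ePoint (A k) (c k) f (w k)) = 0 := by
  rw [← exists_vecMul_eq_zero_iff]
  refine exists_congr fun q => and_congr_right fun _ => ?_
  constructor
  · intro h
    refine ⟨congrFun h 0, congrFun h 1, congrFun h 2, fun j => ?_, fun k => ?_⟩
    · fin_cases j
      exacts [congrFun h 3, congrFun h 4, congrFun h 5]
    · fin_cases k
      exacts [congrFun h 6, congrFun h 7, congrFun h 8, congrFun h 9]
  · rintro ⟨h0, h1, h2, h3, h4⟩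
    ext k
    fin_cases k
    exacts [h0, h1, h2, h3 0, h3 1, h3 2, h4 0, h4 1, h4 2, h4 3]

namespace CollinearFrame

variable {ι : Type*} {C : ι → Matrix (Fin 3) (Fin 4) ℂ} (F : CollinearFrame C)

theorem exists_combination (z : Fin 4 → ℂ) :
    ∃ a b c d : ℂ, z = a • F.u 0 + b • F.u 1 + (c • F.u 2 + d • F.u 3) := by
  obtain ⟨a, rfl⟩ := (vecMul_surjective_iff_isUnit.mpr F.isUnit_of) z
  refine ⟨a 0, a 1, a 2, a 3, ?_⟩
  simp only [vecMul_eq_sum, Fin.sum_univ_four, add_assoc]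
  rfl

/-- A quadric through three points on each of two skew lines contains both lines, so it is a
bilinear form in the coordinates along the two lines. Through the points `e_i`, it exists exactly
when the `p_i ⊗ β_i` satisfy a nontrivial bilinear relation. -/
theorem det_PhiMatrix_eq_zero_iff (e : Fin 4 ≃ ι) {c : Fin 4 → Fin 4 → ℂ}
    {f : Fin 3 → Fin 4 → ℂ} (v : ι → Fin 3 → ℂ)
    (hc : ∀ k, c k = F.x (e k) • F.u 0 + F.y (e k) • F.u 1) (hc0 : c 0 = F.u 0) (hc1 : c 1 = F.u 1)
    (hx : F.x (e 2) ≠ 0) (hy : F.y (e 2) ≠ 0) (hf0 : f 0 = F.u 2) (hf1 : f 1 = F.u 3)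
    {α β : ℂ} (hα : α ≠ 0) (hβ : β ≠ 0) (hf2 : f 2 = α • F.u 2 + β • F.u 3) :
    (PhiMatrix (fun k => C (e k)) c f (fun k => v (e k))).det = 0 ↔
      ∃ b : Matrix (Fin 2) (Fin 2) ℂ, b ≠ 0 ∧ ∀ i, ![F.y i, -F.x i] ⬝ᵥ
        b *ᵥ ![(C i)ᵀ *ᵥ v i ⬝ᵥ F.u 2, (C i)ᵀ *ᵥ v i ⬝ᵥ F.u 3] = 0 := by
  rw [det_PhiMatrix_eq_zero_iff_exists_quadric]
  have hpoint : ∀ k, ePoint (C (e k)) (c k) f (v (e k)) = F.x (e k) • F.u 0 + F.y (e k) • F.u 1 +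
      ((-((C (e k))ᵀ *ᵥ v (e k) ⬝ᵥ F.u 3)) • F.u 2 +
        ((C (e k))ᵀ *ᵥ v (e k) ⬝ᵥ F.u 2) • F.u 3) := by
    intro k
    rw [ePoint, hc, hf0, hf1]
    module
  constructor
  · rintro ⟨q, hq, h0, h1, h2, hf, he⟩
    have h3 := hf 0
    have h4 := hf 1
    have h5 := hf 2
    rw [hc0] at h0
    rw [hc1] at h1
    rw [hf0] at h3
    rw [hf1] at h4
    have h01 : quadricPolar q (F.u 0) (F.u 1) = 0 := by
      have := quadric_combination q F.u (F.x (e 2)) (F.y (e 2)) 0 0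
      rw [zero_smul, zero_smul, add_zero, add_zero, ← hc, h0, h1, h2] at this
      simpa [hx, hy] using this.symm
    have h23 : quadricPolar q (F.u 2) (F.u 3) = 0 := by
      have := quadric_combination q F.u 0 0 α β
      rw [zero_smul, zero_smul, zero_add, zero_add, ← hf2, h3, h4, h5] at this
      simpa [hα, hβ] using this.symm
    refine ⟨!![quadricPolar q (F.u 1) (F.u 3), -quadricPolar q (F.u 1) (F.u 2);
      -quadricPolar q (F.u 0) (F.u 3), quadricPolar q (F.u 0) (F.u 2)], fun hb => hq ?_,
      fun i => ?_⟩
    · have b00 := congrFun₂ hb 0 0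
      have b01 := congrFun₂ hb 0 1
      have b10 := congrFun₂ hb 1 0
      have b11 := congrFun₂ hb 1 1
      simp at b00 b01 b10 b11
      refine eq_zero_of_quadric_eq_zero fun z => ?_
      obtain ⟨a, b, c, d, rfl⟩ := F.exists_combination z
      rw [quadric_combination, h0, h1, h3, h4, h01, h23, b00, b01, b10, b11]
      ring
    · obtain ⟨k, rfl⟩ := e.surjective i
      have := he k
      rw [hpoint, quadric_combination, h0, h1, h3, h4, h01, h23] at this
      rw [← this, pair_dotProduct_mulVec]
      simp
      ring
  · rintro ⟨b, hb, hdep⟩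
    choose η hη using fun k : Fin 4 => F.exists_dotProduct_eq (Pi.single k 1)
    set q : Fin 10 → ℂ := b 0 0 • mulForms (η 1) (η 3) - b 0 1 • mulForms (η 1) (η 2)
      - b 1 0 • mulForms (η 0) (η 3) + b 1 1 • mulForms (η 0) (η 2) with hq
    have hquad : ∀ a a' d d' : ℂ, quadric q (a • F.u 0 + a' • F.u 1 + (d • F.u 2 + d' • F.u 3)) =
        b 0 0 * (a' * d') - b 0 1 * (a' * d) - b 1 0 * (a * d') + b 1 1 * (a * d) := by
      intro a a' d d'
      have : ∀ z, quadric q z = b 0 0 * quadric (mulForms (η 1) (η 3)) z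
          - b 0 1 * quadric (mulForms (η 1) (η 2)) z - b 1 0 * quadric (mulForms (η 0) (η 3)) z
          + b 1 1 * quadric (mulForms (η 0) (η 2)) z := fun z => by
        simp only [quadric, hq, add_dotProduct, sub_dotProduct, smul_dotProduct, smul_eq_mul]
      rw [this]
      simp [quadric_mulForms, dotProduct_add, dotProduct_smul, hη]
    have hline : ∀ a a' : ℂ, quadric q (a • F.u 0 + a' • F.u 1) = 0 := fun a a' => by
      simpa using hquad a a' 0 0
    have hline' : ∀ d d' : ℂ, quadric q (d • F.u 2 + d' • F.u 3) = 0 := fun d d' => by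
      simpa using hquad 0 0 d d'
    refine ⟨q, fun h => hb ?_, ?_, ?_, ?_, fun j => ?_, fun k => ?_⟩
    · simp only [h, quadric, zero_dotProduct] at hquad
      ext i j
      fin_cases i <;> fin_cases j
      · simpa using (hquad 0 1 0 1).symm
      · simpa using (hquad 0 1 1 0).symm
      · simpa using (hquad 1 0 0 1).symm
      · simpa using (hquad 1 0 1 0).symm
    · rw [hc]; exact hline _ _
    · rw [hc]; exact hline _ _
    · rw [hc]; exact hline _ _
    · fin_cases j
      · simpa [hf0] using hline' 1 0
      · simpa [hf1] using hline' 0 1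
      · simpa [hf2] using hline' α β
    · rw [hpoint, hquad, ← hdep (e k), pair_dotProduct_mulVec]
      ring

end CollinearFrame

/-! ### Collinear centers and the coordinate frame -/

/-- Proportional center vectors belong to the same camera. -/
theorem eq_of_center_smul {ι : Type*} {C : ι → Matrix (Fin 3) (Fin 4) ℂ}
    (hrank : ∀ i, (C i).rank = 3) (hdistinct : Function.Injective fun i => center (C i))
    {c : ι → Fin 4 → ℂ} (hc0 : ∀ i, c i ≠ 0) (hc : ∀ i, c i ∈ center (C i)) {i j : ι} {a : ℂ}
    (h : c i = a • c j) : i = j := by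
  have hc' : ∀ i, C i *ᵥ c i = 0 := hc
  have ha : a ≠ 0 := by
    rintro rfl
    exact hc0 i (by simpa using h)
  apply hdistinct
  apply le_antisymm
  · intro d hd
    obtain ⟨k, rfl⟩ := exists_smul_of_mem_center (hrank i) (hc' i) (hc0 i) hd
    rw [h]
    exact Submodule.smul_mem _ _ (Submodule.smul_mem _ _ (hc j))
  · intro d hd
    obtain ⟨k, rfl⟩ := exists_smul_of_mem_center (hrank j) (hc' j) (hc0 j) hd
    have : c j = a⁻¹ • c i := by rw [h, smul_smul, inv_mul_cancel₀ ha, one_smul]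
    change k • c j ∈ center (C i)
    rw [this]
    exact Submodule.smul_mem _ _ (Submodule.smul_mem _ _ (hc i))

/-- Two independent vectors of a two-dimensional subspace span it. -/
theorem exists_combination_of_finrank_eq_two {E : Submodule ℂ (Fin 4 → ℂ)}
    (hE : Module.finrank ℂ E = 2) {p q : Fin 4 → ℂ} (hp : p ∈ E) (hq : q ∈ E)
    (hpq : LinearIndependent ℂ ![p, q]) {z : Fin 4 → ℂ} (hz : z ∈ E) :
    ∃ a b : ℂ, z = a • p + b • q := by
  have hle : Submodule.span ℂ {p, q} ≤ E := by
    rw [Submodule.span_le]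
    rintro _ (rfl | rfl)
    exacts [hp, hq]
  have hfin := finrank_span_eq_card hpq
  rw [Matrix.range_cons_cons_empty, Fintype.card_fin] at hfin
  have heq := Submodule.eq_of_le_of_finrank_eq hle (hfin.trans hE.symm)
  rw [← heq, Submodule.mem_span_pair] at hz
  obtain ⟨a, b, h⟩ := hz
  exact ⟨a, b, h.symm⟩

theorem linearIndependent_of_disjoint {E E' : Submodule ℂ (Fin 4 → ℂ)} (hdisj : Disjoint E E')
    {p q p' q' : Fin 4 → ℂ} (hp : p ∈ E) (hq : q ∈ E) (hp' : p' ∈ E') (hq' : q' ∈ E')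
    (hpq : LinearIndependent ℂ ![p, q]) (hpq' : LinearIndependent ℂ ![p', q']) :
    LinearIndependent ℂ ![p, q, p', q'] := by
  rw [LinearIndependent.pair_iff] at hpq hpq'
  rw [Fintype.linearIndependent_iff]
  intro g hg
  simp only [Fin.sum_univ_four, cons_val] at hg
  have hsum : g 0 • p + g 1 • q = -(g 2 • p' + g 3 • q') :=
    eq_neg_of_add_eq_zero_left (by rw [← hg]; abel)
  have hmem : g 0 • p + g 1 • q ∈ E := E.add_mem (E.smul_mem _ hp) (E.smul_mem _ hq)
  have hmem' : g 0 • p + g 1 • q ∈ E' := by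
    rw [hsum]
    exact E'.neg_mem (E'.add_mem (E'.smul_mem _ hp') (E'.smul_mem _ hq'))
  have hzero := Submodule.disjoint_def.mp hdisj _ hmem hmem'
  have h1 := hpq _ _ hzero
  have h2 := hpq' _ _ (neg_eq_zero.mp (hsum.symm.trans hzero))
  intro k
  fin_cases k
  exacts [h1.1, h1.2, h2.1, h2.2]

end LineMultiview

open LineMultiview Matrix in
theorem theorem5p5 {m : ℕ} (C : Fin m → Matrix (Fin 3) (Fin 4) ℂ)
    (hrank : ∀ i, (C i).rank = 3)
    (hdistinct : Function.Injective fun i => LineMultiview.center (C i))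
    (c : Fin m → Fin 4 → ℂ)
    (hc0 : ∀ i, c i ≠ 0) (hc : ∀ i, c i ∈ LineMultiview.center (C i))
    (σ : Finset (Fin m)) (e : Fin 4 ≃ σ)
    (hcollinear : Module.finrank ℂ (LineMultiview.baseline C σ) = 2)
    (Estar : Submodule ℂ (Fin 4 → ℂ)) (hEstar : Module.finrank ℂ Estar = 2)
    (hdisjoint : Disjoint (LineMultiview.baseline C σ) Estar)
    (f : Fin 3 → Fin 4 → ℂ) (hf0 : ∀ j, f j ≠ 0) (hf : ∀ j, f j ∈ Estar)
    (hfdistinct : Function.Injective fun j => Submodule.span ℂ {f j})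
    (ℓ : Fin m → Projectivization ℂ (Fin 3 → ℂ))
    (v : Fin m → Fin 3 → ℂ) (hv : LineMultiview.IsRep v ℓ) :
    ℓ ∈ LineMultiview.lineMultiviewPreimage C σ ↔
      (LineMultiview.backProjMatrix (fun i : σ => C i) (fun i : σ => v i)).rank ≤ 2 ∧
      (LineMultiview.PhiMatrix (fun k => C (e k)) (fun k => c (e k)) f
        (fun k => v (e k))).det = 0 := by
  have hbase : ∀ i ∈ σ, c i ∈ baseline C σ := fun i hi =>
    Submodule.mem_iSup_of_mem i (Submodule.mem_iSup_of_mem hi (hc i))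
  have hcne : ∀ i j : Fin m, i ≠ j → ∀ a : ℂ, c i ≠ a • c j := fun i j hij a h =>
    hij (eq_of_center_smul hrank hdistinct hc0 hc h)
  have hene : ∀ k l : Fin 4, k ≠ l → (e k : Fin m) ≠ e l := fun k l hkl h =>
    hkl (e.injective (Subtype.ext h))
  have hfne : ∀ j k : Fin 3, j ≠ k → ∀ a : ℂ, f j ≠ a • f k := by
    intro j k hjk a h
    have ha : a ≠ 0 := by
      rintro rfl
      exact hf0 j (by simpa using h)
    apply hjk
    apply hfdistinct
    change Submodule.span ℂ {f j} = Submodule.span ℂ {f k}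
    rw [h, Submodule.span_singleton_smul_eq ha.isUnit]
  have hcli : LinearIndependent ℂ ![c (e 0), c (e 1)] :=
    (LinearIndependent.pair_iff' (hc0 _)).mpr fun a h =>
      hcne _ _ (hene 1 0 (by decide)) a h.symm
  have hfli : LinearIndependent ℂ ![f 0, f 1] :=
    (LinearIndependent.pair_iff' (hf0 _)).mpr fun a h => hfne 1 0 (by decide) a h.symm
  choose x y hxy using fun i : σ => exists_combination_of_finrank_eq_two hcollinear
    (hbase _ (e 0).2) (hbase _ (e 1).2) hcli (hbase i i.2)
  obtain ⟨α, β, hαβ⟩ := exists_combination_of_finrank_eq_two hEstar (hf 0) (hf 1) hfli (hf 2)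
  have hxy0 : ∀ i, x i ≠ 0 ∨ y i ≠ 0 := by
    intro i
    by_contra! h
    apply hc0 i
    rw [hxy i, h.1, h.2, zero_smul, zero_smul, add_zero]
  let F : CollinearFrame (fun i : σ => C i) :=
    { rank_eq := fun i => hrank i
      u := ![c (e 0), c (e 1), f 0, f 1]
      linearIndependent := linearIndependent_of_disjoint hdisjoint (hbase _ (e 0).2)
        (hbase _ (e 1).2) (hf 0) (hf 1) hcli hfli
      x := x
      y := y
      ne_zero := hxy0
      mulVec_center := fun i => by
        have : C i *ᵥ c i = 0 := hc i
        rw [hxy i] at this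
        exact this
      distinct := fun i j hij h => by
        have hij' : (j : Fin m) ≠ i := fun h => hij (Subtype.ext h.symm)
        rcases hxy0 i with hi | hi
        · refine hcne j i hij' (x j / x i) ?_
          have hy : y j = x j / x i * y i := by
            field_simp
            linear_combination h
          have hx : x j = x j / x i * x i := by field_simp
          rw [hxy j, hxy i, smul_add, smul_smul, smul_smul, ← hx, ← hy]
        · refine hcne j i hij' (y j / y i) ?_
          have hx : x j = y j / y i * x i := by
            field_simp
            linear_combination -h
          have hy : y j = y j / y i * y i := by field_simp
          rw [hxy j, hxy i, smul_add, smul_smul, smul_smul, ← hx, ← hy] }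
  have hx2 : x (e 2) ≠ 0 := fun h => hcne _ _ (hene 2 1 (by decide)) (y (e 2)) (by
    rw [hxy (e 2), h, zero_smul, zero_add])
  have hy2 : y (e 2) ≠ 0 := fun h => hcne _ _ (hene 2 0 (by decide)) (x (e 2)) (by
    rw [hxy (e 2), h, zero_smul, add_zero])
  have hα : α ≠ 0 := fun h => hfne 2 1 (by decide) β (by rw [hαβ, h, zero_smul, zero_add])
  have hβ : β ≠ 0 := fun h => hfne 2 0 (by decide) α (by rw [hαβ, h, zero_smul, add_zero])
  have hPhi := F.det_PhiMatrix_eq_zero_iff e (c := fun k => c (e k)) (f := f) (fun i => v i)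
    (fun k => hxy (e k)) rfl rfl hx2 hy2 rfl rfl hα hβ hαβ
  rw [hPhi]
  exact F.mem_variety_iff (fun i => hv i) e
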